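/- **Setting.** A Smale space $(X,\varphi)$ is a homeomorphism $\varphi$ of a compact metric space $(X,d)$ with constants $\varepsilon_X>0$, $0<\lambda<1$ and a continuous bracket $[\cdot,\cdot]\colon\{(x,y): d(x,y)\le\varepsilon_X\}\to X$ such that, whenever both sides are defined, $[x,x]=x$, $[x,[y,z]]=[x,z]$, $[[x,y],z]=[x,z]$, $[\varphi x,\varphi y]=\varphi[x,y]$, and such that $d(\varphi y,\varphi z)\le\lambda d(y,z)$ if $[y,z]=z$ and $d(\varphi^{-1}y,\varphi^{-1}z)\le\lambda d(y,z)$ if $[y,z]=y$. Let $X^s(x)=\{y:\lim_{n\to+\infty}d(\varphi^n x,\varphi^n y)=0\}$ and $X^u(x)=\{y:\lim_{n\to+\infty}d(\varphi^{-n} x,\varphi^{-n} y)=0\}$, with the topologies generated by the local sets $X^s(x,\delta)=\{y: d(x,y)<\delta,\ [y,x]=x\}$ and $X^u(x,\delta)=\{y:d(x,y)<\delta,\ [x,y]=x\}$, $0<\delta\le\varepsilon_X$. A map of Smale spaces is a continuous map $f$ that intertwines the homeomorphisms; it is $s$-bijective (resp. $u$-bijective) if it maps $X^s(x)$ (resp.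 $X^u(x)$) bijectively onto the stable (resp. unstable) set of $f(x)$ for every $x$. Let $CO^s(X)$ be the family of all subsets of $X$ that are contained in some $X^s(e)$ and are compact and open in it. Let $\sim$ be the smallest equivalence relation on $CO^s(X)$ such that (i) $E\sim F$ if $E$ and $F$ lie in local stable sets $X^s(e,\varepsilon_X/2)$, $X^s(f,\varepsilon_X/2)$, all brackets between $E$ and $F$ are defined, and $[E,F]=E$, $[F,E]=F$; (ii) $E\sim F$ if and only if $\varphi(E)\sim\varphi(F)$. The dimension group $D^s(X)$ is the free abelian group on the $\sim$-classes $[E]$ modulo the subgroup generated by all $[E\cup F]-[E]-[F]$ with $E,F,E\cup F\in CO^s(X)$ and $E\cap F=\emptyset$. Let $(X,\varphi)$ be a non-wandering Smale space and $\pi=(Y,\psi,\pi_s,Z,\zeta,\pi_u)$ an $s/u$-bijective pair for it: $(Y,\psi)$, $(Z,\zeta)$ are Smale spaces, $\pi_s\colon Y\to X$ is a surjective $s$-bijective map, $\pi_u\colon Z\to X$ is a surjective $u$-bijective map, and all $Y^u(y)$ and all $Z^s(z)$ are totally disconnected. For $L,M\ge0$ let $$\Sigma_{L,M}=\{(y_0,\dots,y_L,z_0,\dots,z_M)\in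 Y^{L+1}\times Z^{M+1}:\ \pi_s(y_l)=\pi_u(z_m)\text{ for all }l,m\},$$ a Smale space under the maximum metric, the product homeomorphism and the coordinatewise bracket. Order-preserving maps $\alpha\colon\{0,\dots,L'\}\to\{0,\dots,L\}$ and $\beta\colon\{0,\dots,M'\}\to\{0,\dots,M\}$ give maps $\alpha^*\colon\Sigma_{L,M}\to\Sigma_{L',M}$, $(y,z)\mapsto(y\circ\alpha,z)$, and $\beta^*\colon\Sigma_{L,M}\to\Sigma_{L,M'}$, $(y,z)\mapsto(y,z\circ\beta)$, which make $\Sigma_{\bullet,\bullet}$ a bisimplicial space. Its faces $\delta_l$, $\delta_{,m}$ delete $y_l$, $z_m$; its degeneracies $s_l$, $s_{,m}$ repeat $y_l$, $z_m$. **Theorem.** 1. For all $\alpha$ and $\beta$ as above, $[E]\mapsto[\alpha^*(E)]$ is a well-defined homomorphism $D^s(\Sigma_{L,M})\to D^s(\Sigma_{L',M})$ (and $\alpha^*(E)\in CO^s(\Sigma_{L',M})$ for $E\in CO^s(\Sigma_{L,M})$), and $[E]\mapsto[(\beta^*)^{-1}(E)]$ is a well-defined homomorphism $D^s(\Sigma_{L,M'})\to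 D^s(\Sigma_{L,M})$; here $(\beta^*)^{-1}(E)$ is a finite disjoint union of sets $P_i\in CO^s(\Sigma_{L,M})$, and $[(\beta^*)^{-1}(E)]$ stands for $\sum_i[P_i]$, which does not depend on the choice of the $P_i$. 2. With these homomorphisms, $([L],[M])\mapsto D^s(\Sigma_{L,M})$ is a functor $\Delta^{op}\times\Delta\to\mathbf{Ab}$, that is, a simplicial cosimplicial abelian group. Its faces, degeneracies, cofaces and codegeneracies are the maps $\delta_l^s$, $s_l^s$, $\delta_{,m}^{s*}$, $s_{,m}^{s*}$ induced by $\delta_l$, $s_l$, $\delta_{,m}$, $s_{,m}$. 3. Let $C_{L,M}=D^s(\Sigma_{L,M})$ for $L,M\ge0$ (and $C_{L,M}=0$ otherwise), $$\partial^s=\sum_{l=0}^{L}(-1)^l\delta_l^s\colon C_{L,M}\to C_{L-1,M}\ (L\ge1),\qquad \partial^{s*}=\sum_{m=0}^{M+1}(-1)^{L+m}\delta_{,m}^{s*}\colon C_{L,M}\to C_{L,M+1}.$$ Then $\partial^s\partial^s=0$, $\partial^{s*}\partial^{s*}=0$ and $\partial^s\partial^{s*}+\partial^{s*}\partial^s=0$,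 and Putnam's double complex $(C_{L,M},\partial^s,\partial^{s*})$ is equal to the unnormalized double complex of the simplicial cosimplicial group in 2. The latter has horizontal differential the alternating sum of the faces and vertical differential $(-1)^L$ times the alternating sum of the cofaces (the usual sign convention, which makes the differentials anticommute). -/

import Mathlib

open CategoryTheory Opposite

/-- A Smale space: a homeomorphism `φ` of a compact metric space with a bracket `[x, y]`, defined and
jointly continuous for `d(x, y) ≤ ε`, satisfying the axioms B1-B4, C1, C2 of Ruelle and Putnam.
(`bracket` is a total function; only its values at pairs with `d(x, y) ≤ ε` matter.) -/
structure SmaleSpace (X : Type*) [MetricSpace X] [CompactSpace X] where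
  φ : X ≃ₜ X
  ε : ℝ
  lam : ℝ
  bracket : X → X → X
  ε_pos : 0 < ε
  lam_pos : 0 < lam
  lam_lt_one : lam < 1
  continuousOn_bracket :
    ContinuousOn (fun p : X × X => bracket p.1 p.2) {p | dist p.1 p.2 ≤ ε}
  B1 : ∀ x, bracket x x = x
  B2 : ∀ x y z, dist y z ≤ ε → dist x (bracket y z) ≤ ε → dist x z ≤ ε →
    bracket x (bracket y z) = bracket x z
  B3 : ∀ x y z, dist x y ≤ ε → dist (bracket x y) z ≤ ε → dist x z ≤ ε →
    bracket (bracket x y) z = bracket x z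
  B4 : ∀ x y, dist x y ≤ ε → dist (φ x) (φ y) ≤ ε →
    bracket (φ x) (φ y) = φ (bracket x y)
  C1 : ∀ y z, dist y z ≤ ε → bracket y z = z → dist (φ y) (φ z) ≤ lam * dist y z
  C2 : ∀ y z, dist y z ≤ ε → bracket y z = y → dist (φ.symm y) (φ.symm z) ≤ lam * dist y z

namespace SmaleSpace

section Basic

variable {X : Type*} [MetricSpace X] [CompactSpace X] (S : SmaleSpace X)

/-- Every point is non-wandering. -/
def NonWandering : Prop :=
  ∀ (x : X) (U : Set X), IsOpen U → x ∈ U → ∃ n : ℕ, 0 < n ∧ ((S.φ^[n] '' U) ∩ U).Nonempty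

/-- The global stable set `X^s(x)`. -/
def globalStable (x : X) : Set X :=
  {y | Filter.Tendsto (fun n : ℕ => dist (S.φ^[n] x) (S.φ^[n] y)) Filter.atTop (nhds 0)}

/-- The global unstable set `X^u(x)`. -/
def globalUnstable (x : X) : Set X :=
  {y | Filter.Tendsto (fun n : ℕ => dist (S.φ.symm^[n] x) (S.φ.symm^[n] y)) Filter.atTop (nhds 0)}

/-- The local stable set `X^s(x, δ)`, for `0 < δ ≤ ε`. -/
def localStable (x : X) (δ : ℝ) : Set X :=
  {y | dist x y < δ ∧ S.bracket y x = x}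

/-- The local unstable set `X^u(x, δ)`, for `0 < δ ≤ ε`. -/
def localUnstable (x : X) (δ : ℝ) : Set X :=
  {y | dist x y < δ ∧ S.bracket x y = x}

/-- The topology on `X` generated by the local stable sets. Every global stable set is open in it, and
the topology it induces on `X^s(x)` is the usual (inductive limit) topology of `X^s(x)`. -/
@[reducible] def stableTopology : TopologicalSpace X :=
  TopologicalSpace.generateFrom {U | ∃ x δ, 0 < δ ∧ δ ≤ S.ε ∧ U = S.localStable x δ}

/-- The topology on `X` generated by the local unstable sets. -/
@[reducible] def unstableTopology : TopologicalSpace X :=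
  TopologicalSpace.generateFrom {U | ∃ x δ, 0 < δ ∧ δ ≤ S.ε ∧ U = S.localUnstable x δ}

/-- `CO^s`: the compact open subsets of the global stable sets. -/
def CO : Type _ :=
  {E : Set X // (∃ e, E ⊆ S.globalStable e) ∧
    @IsCompact X S.stableTopology E ∧ @IsOpen X S.stableTopology E}

/-- `[E, F] = E` and `[F, E] = F`, all brackets being defined, where `E` and `F` lie in local stable
sets. -/
def Holonomic (E F : Set X) : Prop :=
  (∃ e, E ⊆ S.localStable e (S.ε / 2)) ∧ (∃ f, F ⊆ S.localStable f (S.ε / 2)) ∧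
  (∀ e ∈ E, ∀ f ∈ F, dist e f ≤ S.ε) ∧
  Set.image2 S.bracket E F = E ∧ Set.image2 S.bracket F E = F

/-- The smallest equivalence relation on `CO^s` that contains `Holonomic` and satisfies
`E ∼ F ↔ φ(E) ∼ φ(F)`. -/
inductive Rel : S.CO → S.CO → Prop
  | holonomic (E F : S.CO) : S.Holonomic E.1 F.1 → Rel E F
  | shift (E F E' F' : S.CO) : E'.1 = S.φ '' E.1 → F'.1 = S.φ '' F.1 → Rel E F → Rel E' F'
  | unshift (E F E' F' : S.CO) : E'.1 = S.φ '' E.1 → F'.1 = S.φ '' F.1 → Rel E' F' → Rel E F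
  | refl (E : S.CO) : Rel E E
  | symm (E F : S.CO) : Rel E F → Rel F E
  | trans (E F G : S.CO) : Rel E F → Rel F G → Rel E G

/-- `Rel` as a setoid. -/
def relSetoid : Setoid S.CO where
  r := S.Rel
  iseqv := ⟨Rel.refl, fun h => Rel.symm _ _ h, fun h h' => Rel.trans _ _ _ h h'⟩

/-- The generator of the free abelian group attached to the class of `E`. -/
def freeCls (E : S.CO) : FreeAbelianGroup (Quotient S.relSetoid) :=
  FreeAbelianGroup.of (Quotient.mk S.relSetoid E)

/-- The subgroup generated by `[E ∪ F] - [E] - [F]` for disjoint `E`, `F`. -/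
def additivity : AddSubgroup (FreeAbelianGroup (Quotient S.relSetoid)) :=
  AddSubgroup.closure {a | ∃ E F G : S.CO, Disjoint E.1 F.1 ∧ G.1 = E.1 ∪ F.1 ∧
    a = S.freeCls G - S.freeCls E - S.freeCls F}

/-- The (stable) dimension group `D^s`. -/
abbrev Ds : Type _ := FreeAbelianGroup (Quotient S.relSetoid) ⧸ S.additivity

/-- The class `[E]` in `D^s`. -/
def cls (E : S.CO) : S.Ds := QuotientAddGroup.mk (S.freeCls E)

end Basic

section Maps

variable {A B : Type*} [MetricSpace A] [CompactSpace A] [MetricSpace B] [CompactSpace B]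
  (S : SmaleSpace A) (T : SmaleSpace B)

/-- A map of Smale spaces. -/
def IsMap (f : A → B) : Prop :=
  Continuous f ∧ ∀ x, f (S.φ x) = T.φ (f x)

/-- `f` is `s`-bijective. -/
def SBijective (f : A → B) : Prop :=
  ∀ x, Set.BijOn f (S.globalStable x) (T.globalStable (f x))

/-- `f` is `u`-bijective. -/
def UBijective (f : A → B) : Prop :=
  ∀ x, Set.BijOn f (S.globalUnstable x) (T.globalUnstable (f x))

/-- `g` is the map `[E] ↦ [f(E)]`. -/
def IsPush (f : A → B) (g : S.Ds →+ T.Ds) : Prop :=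
  ∀ E : S.CO, ∃ E' : T.CO, E'.1 = f '' E.1 ∧ g (S.cls E) = T.cls E'

/-- `P` is a partition of `f⁻¹(E)` into finitely many members of `CO^s`. -/
def IsPreimagePartition (f : A → B) (E : T.CO) {n : ℕ} (P : Fin n → S.CO) : Prop :=
  (∀ i j, i ≠ j → Disjoint (P i).1 (P j).1) ∧ (⋃ i, (P i).1) = f ⁻¹' E.1

/-- `g` is the map `[E] ↦ [f⁻¹(E)]`: the set `f⁻¹(E)` (which may meet several stable sets) is a finite
disjoint union of members `P i` of `CO^s`, and `[E]` goes to `∑ [P i]`, for any such partition. -/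
def IsPull (f : A → B) (g : T.Ds →+ S.Ds) : Prop :=
  ∀ E : T.CO,
    (∃ (n : ℕ) (P : Fin n → S.CO), S.IsPreimagePartition T f E P) ∧
    ∀ (n : ℕ) (P : Fin n → S.CO), S.IsPreimagePartition T f E P →
      g (T.cls E) = ∑ i, S.cls (P i)

open Classical in
/-- The map `f^s : [E] ↦ [f(E)]` on dimension groups (zero if there is no such homomorphism). -/
noncomputable def push (f : A → B) : S.Ds →+ T.Ds :=
  if h : ∃ g, S.IsPush T f g then h.choose else 0

open Classical in
/-- The map `f^{s*} : [E] ↦ [f⁻¹(E)]` on dimension groups (zero if there is no such homomorphism). -/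
noncomputable def pull (f : A → B) : T.Ds →+ S.Ds :=
  if h : ∃ g, S.IsPull T f g then h.choose else 0

end Maps

section BracketLemmas

variable {X : Type*} [MetricSpace X] [CompactSpace X]

/-- The inverse system. -/
def inv (S : SmaleSpace X) : SmaleSpace X where
  φ := S.φ.symm
  ε := S.ε
  lam := S.lam
  bracket x y := S.bracket y x
  ε_pos := S.ε_pos
  lam_pos := S.lam_pos
  lam_lt_one := S.lam_lt_one
  continuousOn_bracket := by
    refine S.continuousOn_bracket.comp continuous_swap.continuousOn ?_
    intro p hp
    simpa [dist_comm] using hp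
  B1 := S.B1
  B2 x y z h1 h2 h3 := by
    rw [dist_comm] at h1 h2 h3
    exact S.B3 _ _ _ h1 h2 h3
  B3 x y z h1 h2 h3 := by
    rw [dist_comm] at h1 h2 h3
    exact S.B2 _ _ _ h1 h2 h3
  B4 x y h1 h2 := by
    rw [dist_comm] at h1 h2
    have := S.B4 (S.φ.symm y) (S.φ.symm x) h2 (by simpa using h1)
    apply S.φ.injective
    simpa using this.symm
  C1 y z h1 h2 := by
    rw [dist_comm] at h1
    rw [dist_comm, dist_comm y z]
    exact S.C2 _ _ h1 h2
  C2 y z h1 h2 := by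
    rw [dist_comm] at h1
    rw [dist_comm, dist_comm y z]
    exact S.C1 _ _ h1 h2

theorem bracket_near (S : SmaleSpace X) {η : ℝ} (hη : 0 < η) :
    ∃ δ > 0, δ ≤ S.ε ∧ ∀ x y, dist x y ≤ δ →
      dist (S.bracket x y) x < η ∧ dist (S.bracket x y) y < η := by
  have hK : IsCompact {p : X × X | dist p.1 p.2 ≤ S.ε} :=
    (isClosed_le continuous_dist continuous_const).isCompact
  have hu := hK.uniformContinuousOn_of_continuous S.continuousOn_bracket
  rw [Metric.uniformContinuousOn_iff] at hu
  obtain ⟨δ, hδ, h⟩ := hu (η / 2) (by linarith)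
  refine ⟨min (min (δ / 2) (η / 2)) S.ε, ?_, min_le_right _ _, ?_⟩
  · have := S.ε_pos
    positivity
  intro x y hxy
  have h1 : dist x y ≤ δ / 2 := hxy.trans ((min_le_left _ _).trans (min_le_left _ _))
  have h2 : dist x y ≤ η / 2 := hxy.trans ((min_le_left _ _).trans (min_le_right _ _))
  have h3 : dist x y ≤ S.ε := hxy.trans (min_le_right _ _)
  have h4 := h (x, y) h3 (x, x) (by simpa using S.ε_pos.le) (by
    rw [Prod.dist_eq]
    simp only [dist_self]
    rw [dist_comm y x]
    exact max_lt hδ (by linarith))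
  simp only [S.B1] at h4
  refine ⟨by linarith, ?_⟩
  have := dist_triangle (S.bracket x y) x y
  linarith

theorem stable_iterate (S : SmaleSpace X) {y w : X} (h : dist y w ≤ S.ε)
    (hb : S.bracket y w = w) (n : ℕ) :
    dist (S.φ^[n] y) (S.φ^[n] w) ≤ S.lam ^ n * dist y w ∧
      dist (S.φ^[n] y) (S.φ^[n] w) ≤ S.ε ∧
      S.bracket (S.φ^[n] y) (S.φ^[n] w) = S.φ^[n] w := by
  induction n with
  | zero => simpa using ⟨h, hb⟩
  | succ n ih =>
    obtain ⟨h1, h2, h3⟩ := ih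
    have h4 := S.C1 _ _ h2 h3
    have h5 : S.lam * dist (S.φ^[n] y) (S.φ^[n] w) ≤ dist (S.φ^[n] y) (S.φ^[n] w) :=
      mul_le_of_le_one_left dist_nonneg S.lam_lt_one.le
    simp only [Function.iterate_succ_apply']
    refine ⟨?_, h4.trans (h5.trans h2), ?_⟩
    · calc _ ≤ _ := h4
        _ ≤ S.lam * (S.lam ^ n * dist y w) := mul_le_mul_of_nonneg_left h1 S.lam_pos.le
        _ = _ := by ring
    · rw [S.B4 _ _ h2 (h4.trans (h5.trans h2)), h3]

theorem stable_iterate_le (S : SmaleSpace X) {y w : X} (h : dist y w ≤ S.ε)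
    (hb : S.bracket y w = w) (n : ℕ) :
    dist (S.φ^[n] y) (S.φ^[n] w) ≤ dist y w :=
  (S.stable_iterate h hb n).1.trans
    (mul_le_of_le_one_left dist_nonneg (pow_le_one₀ S.lam_pos.le S.lam_lt_one.le))

theorem exists_shadow (S : SmaleSpace X) :
    ∃ δ > 0, δ ≤ S.ε ∧ ∀ a b, (∀ n : ℕ, dist (S.φ^[n] b) (S.φ^[n] a) ≤ δ) →
      S.bracket b a = a := by
  obtain ⟨δ, hδ, hδε, h⟩ := S.bracket_near S.ε_pos
  refine ⟨δ, hδ, hδε, fun a b hab => ?_⟩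
  have hv : ∀ n : ℕ, S.bracket (S.φ^[n] b) (S.φ^[n] a) = S.φ^[n] (S.bracket b a) := by
    intro n
    induction n with
    | zero => rfl
    | succ n ih =>
      have h1 := (hab n).trans hδε
      have h2 := (hab (n + 1)).trans hδε
      simp only [Function.iterate_succ_apply'] at h2 ⊢
      rw [S.B4 _ _ h1 h2, ih]
  have hd : ∀ n : ℕ, dist (S.bracket b a) a ≤ S.lam ^ n * S.ε := by
    intro n
    have h1 := (h _ _ (hab n)).2.le
    have h2 := (hab n).trans hδε
    have h3 : S.inv.bracket (S.φ^[n] a) (S.φ^[n] (S.bracket b a)) =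
        S.φ^[n] (S.bracket b a) := by
      rw [← hv n]
      exact S.B3 _ _ _ h2 h1 h2
    rw [hv n] at h1
    have h4 := (S.inv.stable_iterate (by rw [dist_comm]; exact h1) h3 n).1
    have h5 : ∀ x, S.inv.φ^[n] (S.φ^[n] x) = x :=
      Function.LeftInverse.iterate (fun x => S.φ.symm_apply_apply x) n
    rw [h5, h5, dist_comm, dist_comm (S.φ^[n] a)] at h4
    exact h4.trans (mul_le_mul_of_nonneg_left h1 (pow_nonneg S.lam_pos.le n))
  have hlim : Filter.Tendsto (fun n : ℕ => S.lam ^ n * S.ε) Filter.atTop (nhds (0 * S.ε)) :=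
    (tendsto_pow_atTop_nhds_zero_of_lt_one S.lam_pos.le S.lam_lt_one).mul_const _
  rw [zero_mul] at hlim
  exact dist_le_zero.1 (ge_of_tendsto' hlim hd)

variable {Y : Type*} [MetricSpace Y] [CompactSpace Y]

/-- Maps of Smale spaces preserve brackets of sufficiently close points. -/
theorem exists_bracket_map (S : SmaleSpace Y) (T : SmaleSpace X) {f : Y → X} (hf : S.IsMap T f) :
    ∃ δ > 0, δ ≤ S.ε ∧ ∀ y y', dist y y' ≤ δ →
      f (S.bracket y y') = T.bracket (f y) (f y') := by
  obtain ⟨δ₁, hδ₁, hδ₁ε, hs⟩ := T.exists_shadow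
  obtain ⟨δ₂, hδ₂, hδ₂ε, hu⟩ := T.inv.exists_shadow
  change δ₂ ≤ T.ε at hδ₂ε
  have huc := CompactSpace.uniformContinuous_of_continuous hf.1
  rw [Metric.uniformContinuous_iff] at huc
  obtain ⟨η, hη, hfη⟩ := huc (min δ₁ δ₂) (lt_min hδ₁ hδ₂)
  obtain ⟨δ, hδ, hδε, hb⟩ := S.bracket_near (lt_min hη S.ε_pos)
  refine ⟨min δ (η / 2), lt_min hδ (by linarith), (min_le_left _ _).trans hδε, ?_⟩
  intro y y' hyy
  have hyδ := hyy.trans (min_le_left _ _)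
  have hyη : dist y y' < η := (hyy.trans (min_le_right _ _)).trans_lt (by linarith)
  obtain ⟨h1, h2⟩ := hb y y' hyδ
  set w := S.bracket y y' with hw
  have h1ε : dist y w ≤ S.ε := by rw [dist_comm]; exact (h1.trans_le (min_le_right _ _)).le
  have h2ε : dist w y' ≤ S.ε := (h2.trans_le (min_le_right _ _)).le
  have hyε := hyδ.trans hδε
  have e1 : S.bracket y w = w := S.B2 _ _ _ hyε h1ε hyε
  have e2 : S.inv.bracket y' w = w := S.B3 _ _ _ hyε h2ε hyε
  have it1 : ∀ (n : ℕ) x, f (S.φ^[n] x) = T.φ^[n] (f x) := by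
    intro n x
    exact (Function.Semiconj.iterate_right (f := f) (ga := S.φ) (gb := T.φ) hf.2 n) x
  have it2 : ∀ (n : ℕ) x, f (S.inv.φ^[n] x) = T.inv.φ^[n] (f x) := by
    intro n x
    refine (Function.Semiconj.iterate_right (f := f) (ga := S.inv.φ) (gb := T.inv.φ) ?_ n) x
    intro x
    apply T.φ.injective
    change T.φ (f (S.φ.symm x)) = T.φ (T.φ.symm (f x))
    rw [← hf.2]
    simp
  have f1 : T.bracket (f y) (f w) = f w := by
    refine hs _ _ fun n => ?_
    rw [← it1, ← it1]
    refine ((hfη ?_).trans_le (min_le_left _ _)).le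
    refine (S.stable_iterate_le h1ε e1 n).trans_lt ?_
    rw [dist_comm]
    exact h1.trans_le (min_le_left _ _)
  have f2 : T.inv.bracket (f y') (f w) = f w := by
    refine hu _ _ fun n => ?_
    rw [← it2, ← it2]
    refine ((hfη ?_).trans_le (min_le_right _ _)).le
    refine (S.inv.stable_iterate_le (by rw [dist_comm]; exact h2ε) e2 n).trans_lt ?_
    rw [dist_comm]
    exact h2.trans_le (min_le_left _ _)
  change T.bracket (f w) (f y') = f w at f2
  have g1 : dist (f y) (f w) ≤ T.ε := by
    refine ((hfη ?_).trans_le ((min_le_left _ _).trans hδ₁ε)).le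
    rw [dist_comm]
    exact h1.trans_le (min_le_left _ _)
  have g2 : dist (f w) (f y') ≤ T.ε :=
    ((hfη (h2.trans_le (min_le_left _ _))).trans_le ((min_le_left _ _).trans hδ₁ε)).le
  have g3 : dist (f y) (f y') ≤ T.ε :=
    ((hfη hyη).trans_le ((min_le_left _ _).trans hδ₁ε)).le
  have := T.B3 (f y) (f w) (f y') g1 (by rw [f1]; exact g2) g3
  rw [f1, f2] at this
  exact this

end BracketLemmas

end SmaleSpace

/-- An `s/u`-bijective pair `π = (Y, ψ, π_s, Z, ζ, π_u)` for the Smale space `S`: factor maps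
`π_s : Y → X`, `π_u : Z → X`, the first `s`-bijective with totally disconnected unstable sets upstairs,
the second `u`-bijective with totally disconnected stable sets upstairs. -/
structure SUBijectivePair {X : Type*} [MetricSpace X] [CompactSpace X] (S : SmaleSpace X)
    (Y Z : Type*) [MetricSpace Y] [CompactSpace Y] [MetricSpace Z] [CompactSpace Z] where
  SY : SmaleSpace Y
  SZ : SmaleSpace Z
  πs : Y → X
  πu : Z → X
  isMap_πs : SY.IsMap S πs
  isMap_πu : SZ.IsMap S πu
  surjective_πs : Function.Surjective πs
  surjective_πu : Function.Surjective πu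
  sBijective_πs : SY.SBijective S πs
  uBijective_πu : SZ.UBijective S πu
  totallyDisconnected_unstable :
    ∀ y, @IsTotallyDisconnected Y SY.unstableTopology (SY.globalUnstable y)
  totallyDisconnected_stable :
    ∀ z, @IsTotallyDisconnected Z SZ.stableTopology (SZ.globalStable z)

namespace SUBijectivePair

section Spaces

variable {X Y Z : Type*} [MetricSpace X] [CompactSpace X] [MetricSpace Y] [CompactSpace Y]
  [MetricSpace Z] [CompactSpace Z] {S : SmaleSpace X} (π : SUBijectivePair S Y Z)

/-- The space `Σ_{L,M}(π)`, with the maximum metric. -/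
abbrev Sig (L M : ℕ) : Type _ :=
  {p : (Fin (L + 1) → Y) × (Fin (M + 1) → Z) // ∀ l m, π.πs (p.1 l) = π.πu (p.2 m)}

instance (L M : ℕ) : CompactSpace (π.Sig L M) := by
  refine isCompact_iff_compactSpace.1 (IsClosed.isCompact ?_)
  have : {p : (Fin (L + 1) → Y) × (Fin (M + 1) → Z) | ∀ l m, π.πs (p.1 l) = π.πu (p.2 m)} =
      ⋂ l, ⋂ m, {p | π.πs (p.1 l) = π.πu (p.2 m)} := by
    ext p
    simp
  change IsClosed {p : (Fin (L + 1) → Y) × (Fin (M + 1) → Z) | ∀ l m, π.πs (p.1 l) = π.πu (p.2 m)}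
  rw [this]
  refine isClosed_iInter fun l => isClosed_iInter fun m => isClosed_eq ?_ ?_
  · exact π.isMap_πs.1.comp ((continuous_apply l).comp continuous_fst)
  · exact π.isMap_πu.1.comp ((continuous_apply m).comp continuous_snd)

theorem exists_scale : ∃ δ > 0, δ ≤ π.SY.ε ∧ δ ≤ π.SZ.ε ∧
    (∀ y y', dist y y' ≤ δ → π.πs (π.SY.bracket y y') = S.bracket (π.πs y) (π.πs y')) ∧
    (∀ z z', dist z z' ≤ δ → π.πu (π.SZ.bracket z z') = S.bracket (π.πu z) (π.πu z')) := by
  obtain ⟨a, ha, ha', h⟩ := π.SY.exists_bracket_map S π.isMap_πs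
  obtain ⟨b, hb, hb', h'⟩ := π.SZ.exists_bracket_map S π.isMap_πu
  exact ⟨min a b, lt_min ha hb, (min_le_left _ _).trans ha', (min_le_right _ _).trans hb',
    fun y y' hy => h y y' (hy.trans (min_le_left _ _)),
    fun z z' hz => h' z z' (hz.trans (min_le_right _ _))⟩

/-- A scale below which brackets are defined in `Y`, `Z` and preserved by `π_s`, `π_u`. -/
noncomputable def scale : ℝ := π.exists_scale.choose

/-- The product homeomorphism `ψ × ⋯ × ψ × ζ × ⋯ × ζ` on `Σ_{L,M}(π)`. -/
def sigHomeo (L M : ℕ) : π.Sig L M ≃ₜ π.Sig L M where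
  toFun p := ⟨(fun l => π.SY.φ (p.1.1 l), fun m => π.SZ.φ (p.1.2 m)), fun l m => by
    rw [π.isMap_πs.2, π.isMap_πu.2, p.2 l m]⟩
  invFun p := ⟨(fun l => π.SY.φ.symm (p.1.1 l), fun m => π.SZ.φ.symm (p.1.2 m)), fun l m => by
    apply S.φ.injective
    rw [← π.isMap_πs.2, ← π.isMap_πu.2]
    simpa using p.2 l m⟩
  left_inv p := by ext <;> simp
  right_inv p := by ext <;> simp
  continuous_toFun := by fun_prop
  continuous_invFun := by fun_prop

open Classical in
/-- The coordinatewise bracket on `Σ_{L,M}(π)` (with a dummy value for points that are not close). -/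
noncomputable def sigBracket (L M : ℕ) (p q : π.Sig L M) : π.Sig L M :=
  if h : ∀ l m, π.πs (π.SY.bracket (p.1.1 l) (q.1.1 l)) = π.πu (π.SZ.bracket (p.1.2 m) (q.1.2 m))
  then ⟨(fun l => π.SY.bracket (p.1.1 l) (q.1.1 l), fun m => π.SZ.bracket (p.1.2 m) (q.1.2 m)), h⟩
  else p

theorem dist_fst_le {L M : ℕ} (p q : π.Sig L M) (l : Fin (L + 1)) :
    dist (p.1.1 l) (q.1.1 l) ≤ dist p q :=
  (dist_le_pi_dist p.1.1 q.1.1 l).trans (le_max_left _ _)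

theorem dist_snd_le {L M : ℕ} (p q : π.Sig L M) (m : Fin (M + 1)) :
    dist (p.1.2 m) (q.1.2 m) ≤ dist p q :=
  (dist_le_pi_dist p.1.2 q.1.2 m).trans (le_max_right _ _)

theorem dist_le_of {L M : ℕ} (p q : π.Sig L M) {r : ℝ} (hr : 0 ≤ r)
    (h1 : ∀ l, dist (p.1.1 l) (q.1.1 l) ≤ r) (h2 : ∀ m, dist (p.1.2 m) (q.1.2 m) ≤ r) :
    dist p q ≤ r :=
  max_le ((dist_pi_le_iff hr).2 h1) ((dist_pi_le_iff hr).2 h2)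

theorem sigBracket_coe {L M : ℕ} {p q : π.Sig L M} (h : dist p q ≤ π.scale) :
    (π.sigBracket L M p q).1 =
      (fun l => π.SY.bracket (p.1.1 l) (q.1.1 l), fun m => π.SZ.bracket (p.1.2 m) (q.1.2 m)) := by
  have hs := π.exists_scale.choose_spec
  unfold sigBracket
  rw [dif_pos]
  intro l m
  rw [hs.2.2.2.1 _ _ ((π.dist_fst_le p q l).trans h),
    hs.2.2.2.2 _ _ ((π.dist_snd_le p q m).trans h), p.2 l m, q.2 l m]

/-- `Σ_{L,M}(π)` as a Smale space. -/
noncomputable def sig (L M : ℕ) : SmaleSpace (π.Sig L M) where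
  φ := π.sigHomeo L M
  ε := π.scale
  lam := max π.SY.lam π.SZ.lam
  bracket := π.sigBracket L M
  ε_pos := π.exists_scale.choose_spec.1
  lam_pos := lt_max_of_lt_left π.SY.lam_pos
  lam_lt_one := max_lt π.SY.lam_lt_one π.SZ.lam_lt_one
  continuousOn_bracket := by
    have hs := π.exists_scale.choose_spec
    refine (Topology.IsInducing.continuousOn_iff (g := fun p : π.Sig L M => p.1)
      Topology.IsInducing.subtypeVal).2 ?_
    refine ContinuousOn.congr (f := fun p : π.Sig L M × π.Sig L M =>
      ((fun l => π.SY.bracket (p.1.1.1 l) (p.2.1.1 l), fun m => π.SZ.bracket (p.1.1.2 m) (p.2.1.2 m)) :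
        (Fin (L + 1) → Y) × (Fin (M + 1) → Z))) ?_ (fun p hp => π.sigBracket_coe hp)
    refine ContinuousOn.prodMk (continuousOn_pi.2 fun l => ?_) (continuousOn_pi.2 fun m => ?_)
    · refine π.SY.continuousOn_bracket.comp
        (f := fun p : π.Sig L M × π.Sig L M => (p.1.1.1 l, p.2.1.1 l))
        (Continuous.continuousOn (by fun_prop)) ?_
      intro p hp
      exact (π.dist_fst_le p.1 p.2 l).trans (le_trans hp hs.2.1)
    · refine π.SZ.continuousOn_bracket.comp
        (f := fun p : π.Sig L M × π.Sig L M => (p.1.1.2 m, p.2.1.2 m))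
        (Continuous.continuousOn (by fun_prop)) ?_
      intro p hp
      exact (π.dist_snd_le p.1 p.2 m).trans (le_trans hp hs.2.2.1)
  B1 p := by
    have hs := π.exists_scale.choose_spec
    apply Subtype.ext
    rw [π.sigBracket_coe (by rw [dist_self]; exact hs.1.le)]
    simp only [π.SY.B1, π.SZ.B1]
  B2 x y z h1 h2 h3 := by
    have hs := π.exists_scale.choose_spec
    apply Subtype.ext
    have k1 := fun l => (π.dist_fst_le _ _ l).trans h2
    have k2 := fun m => (π.dist_snd_le _ _ m).trans h2
    rw [π.sigBracket_coe h2, π.sigBracket_coe h3]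
    rw [π.sigBracket_coe h1] at k1 k2 ⊢
    ext i
    · exact π.SY.B2 _ _ _ ((π.dist_fst_le _ _ i).trans (h1.trans hs.2.1)) ((k1 i).trans hs.2.1)
        ((π.dist_fst_le _ _ i).trans (h3.trans hs.2.1))
    · exact π.SZ.B2 _ _ _ ((π.dist_snd_le _ _ i).trans (h1.trans hs.2.2.1)) ((k2 i).trans hs.2.2.1)
        ((π.dist_snd_le _ _ i).trans (h3.trans hs.2.2.1))
  B3 x y z h1 h2 h3 := by
    have hs := π.exists_scale.choose_spec
    apply Subtype.ext
    have k1 := fun l => (π.dist_fst_le _ _ l).trans h2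
    have k2 := fun m => (π.dist_snd_le _ _ m).trans h2
    rw [π.sigBracket_coe h2, π.sigBracket_coe h3]
    rw [π.sigBracket_coe h1] at k1 k2 ⊢
    ext i
    · exact π.SY.B3 _ _ _ ((π.dist_fst_le _ _ i).trans (h1.trans hs.2.1)) ((k1 i).trans hs.2.1)
        ((π.dist_fst_le _ _ i).trans (h3.trans hs.2.1))
    · exact π.SZ.B3 _ _ _ ((π.dist_snd_le _ _ i).trans (h1.trans hs.2.2.1)) ((k2 i).trans hs.2.2.1)
        ((π.dist_snd_le _ _ i).trans (h3.trans hs.2.2.1))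
  B4 x y h1 h2 := by
    have hs := π.exists_scale.choose_spec
    apply Subtype.ext
    rw [π.sigBracket_coe h2]
    change _ = ((fun l => π.SY.φ ((π.sigBracket L M x y).1.1 l),
      fun m => π.SZ.φ ((π.sigBracket L M x y).1.2 m)) : (Fin (L + 1) → Y) × (Fin (M + 1) → Z))
    rw [π.sigBracket_coe h1]
    ext i
    · exact π.SY.B4 _ _ ((π.dist_fst_le _ _ i).trans (h1.trans hs.2.1))
        ((π.dist_fst_le _ _ i).trans (h2.trans hs.2.1))
    · exact π.SZ.B4 _ _ ((π.dist_snd_le _ _ i).trans (h1.trans hs.2.2.1))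
        ((π.dist_snd_le _ _ i).trans (h2.trans hs.2.2.1))
  C1 y z h hb := by
    have hs := π.exists_scale.choose_spec
    have hc := congrArg Subtype.val hb
    rw [π.sigBracket_coe h] at hc
    have hl : 0 ≤ max π.SY.lam π.SZ.lam := (lt_max_of_lt_left π.SY.lam_pos).le
    refine π.dist_le_of _ _ (mul_nonneg hl dist_nonneg) (fun l => ?_) (fun m => ?_)
    · refine (π.SY.C1 _ _ ((π.dist_fst_le _ _ l).trans (h.trans hs.2.1))
        (congrFun (congrArg Prod.fst hc) l)).trans ?_
      exact mul_le_mul (le_max_left _ _) (π.dist_fst_le _ _ l) dist_nonneg hl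
    · refine (π.SZ.C1 _ _ ((π.dist_snd_le _ _ m).trans (h.trans hs.2.2.1))
        (congrFun (congrArg Prod.snd hc) m)).trans ?_
      exact mul_le_mul (le_max_right _ _) (π.dist_snd_le _ _ m) dist_nonneg hl
  C2 y z h hb := by
    have hs := π.exists_scale.choose_spec
    have hc := congrArg Subtype.val hb
    rw [π.sigBracket_coe h] at hc
    have hl : 0 ≤ max π.SY.lam π.SZ.lam := (lt_max_of_lt_left π.SY.lam_pos).le
    refine π.dist_le_of _ _ (mul_nonneg hl dist_nonneg) (fun l => ?_) (fun m => ?_)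
    · refine (π.SY.C2 _ _ ((π.dist_fst_le _ _ l).trans (h.trans hs.2.1))
        (congrFun (congrArg Prod.fst hc) l)).trans ?_
      exact mul_le_mul (le_max_left _ _) (π.dist_fst_le _ _ l) dist_nonneg hl
    · refine (π.SZ.C2 _ _ ((π.dist_snd_le _ _ m).trans (h.trans hs.2.2.1))
        (congrFun (congrArg Prod.snd hc) m)).trans ?_
      exact mul_le_mul (le_max_right _ _) (π.dist_snd_le _ _ m) dist_nonneg hl

/-- The structure map `(y, z) ↦ (y ∘ α, z)` of the bisimplicial space, for `α : [L'] → [L]`. -/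
def reindexY {L L' : ℕ} (M : ℕ) (α : Fin (L' + 1) → Fin (L + 1)) (p : π.Sig L M) : π.Sig L' M :=
  ⟨(fun l => p.1.1 (α l), p.1.2), fun l m => p.2 (α l) m⟩

/-- The structure map `(y, z) ↦ (y, z ∘ β)` of the bisimplicial space, for `β : [M'] → [M]`. -/
def reindexZ (L : ℕ) {M M' : ℕ} (β : Fin (M' + 1) → Fin (M + 1)) (p : π.Sig L M) : π.Sig L M' :=
  ⟨(p.1.1, fun m => p.1.2 (β m)), fun l m => p.2 l (β m)⟩

/-- `δ_l : Σ_{L+1,M} → Σ_{L,M}` deletes `y_l`. -/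
def faceY (L M : ℕ) (l : Fin (L + 2)) : π.Sig (L + 1) M → π.Sig L M := π.reindexY M l.succAbove

/-- `s_l : Σ_{L,M} → Σ_{L+1,M}` repeats `y_l`. -/
def degenY (L M : ℕ) (l : Fin (L + 1)) : π.Sig L M → π.Sig (L + 1) M := π.reindexY M l.predAbove

/-- `δ_{,m} : Σ_{L,M+1} → Σ_{L,M}` deletes `z_m`. -/
def faceZ (L M : ℕ) (m : Fin (M + 2)) : π.Sig L (M + 1) → π.Sig L M := π.reindexZ L m.succAbove

/-- `s_{,m} : Σ_{L,M} → Σ_{L,M+1}` repeats `z_m`. -/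
def degenZ (L M : ℕ) (m : Fin (M + 1)) : π.Sig L M → π.Sig L (M + 1) := π.reindexZ L m.predAbove

/-- The map `D^s(Σ_{L,M}) → D^s(Σ_{L',M})` induced covariantly by `α : [L'] → [L]`. -/
noncomputable def covY {L L' : ℕ} (M : ℕ) (α : Fin (L' + 1) → Fin (L + 1)) :
    (π.sig L M).Ds →+ (π.sig L' M).Ds :=
  (π.sig L M).push (π.sig L' M) (π.reindexY M α)

/-- The map `D^s(Σ_{L,M'}) → D^s(Σ_{L,M})` induced contravariantly by `β : [M'] → [M]`. -/
noncomputable def conZ (L : ℕ) {M M' : ℕ} (β : Fin (M' + 1) → Fin (M + 1)) :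
    (π.sig L M').Ds →+ (π.sig L M).Ds :=
  (π.sig L M).pull (π.sig L M') (π.reindexZ L β)

/-- The laws saying that `[L], [M] ↦ D^s(Σ_{L,M})`, with the maps `covY` and `conZ`, is a functor
`Δᵒᵖ × Δ → Ab`. -/
structure DsFunctorial : Prop where
  covY_id : ∀ L M, π.covY M (id : Fin (L + 1) → Fin (L + 1)) = AddMonoidHom.id _
  covY_comp : ∀ {L L' L'' : ℕ} (M : ℕ) (α : Fin (L' + 1) →o Fin (L + 1))
    (α' : Fin (L'' + 1) →o Fin (L' + 1)), π.covY M (α ∘ α') = (π.covY M α').comp (π.covY M α)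
  conZ_id : ∀ L M, π.conZ L (id : Fin (M + 1) → Fin (M + 1)) = AddMonoidHom.id _
  conZ_comp : ∀ (L : ℕ) {M M' M'' : ℕ} (β : Fin (M' + 1) →o Fin (M + 1))
    (β' : Fin (M'' + 1) →o Fin (M' + 1)), π.conZ L (β ∘ β') = (π.conZ L β).comp (π.conZ L β')
  comm : ∀ {L L' M M' : ℕ} (α : Fin (L' + 1) →o Fin (L + 1)) (β : Fin (M' + 1) →o Fin (M + 1)),
    (π.covY M α).comp (π.conZ L β) = (π.conZ L' β).comp (π.covY M' α)

/-- The simplicial cosimplicial abelian group `D^s(Σ_{•,•}(π))`. -/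
noncomputable def dsObject (h : π.DsFunctorial) :
    SimplicialObject (CosimplicialObject AddCommGrpCat) where
  obj a :=
    { obj b := AddCommGrpCat.of (π.sig a.unop.len b.len).Ds
      map β := AddCommGrpCat.ofHom (π.conZ a.unop.len β.toOrderHom)
      map_id b := by
        apply AddCommGrpCat.hom_ext
        exact h.conZ_id _ _
      map_comp β β' := by
        apply AddCommGrpCat.hom_ext
        exact h.conZ_comp _ β'.toOrderHom β.toOrderHom }
  map α :=
    { app b := AddCommGrpCat.ofHom (π.covY b.len α.unop.toOrderHom)
      naturality b b' β := by
        apply AddCommGrpCat.hom_ext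
        exact h.comm α.unop.toOrderHom β.toOrderHom }
  map_id a := by
    apply NatTrans.ext
    funext b
    apply AddCommGrpCat.hom_ext
    exact h.covY_id _ _
  map_comp α α' := by
    apply NatTrans.ext
    funext b
    apply AddCommGrpCat.hom_ext
    exact h.covY_comp _ α.unop.toOrderHom α'.unop.toOrderHom

/-- `∂^s_{L+1,M} = ∑_l (-1)^l δ_l^s`. -/
noncomputable def dS (L M : ℕ) : (π.sig (L + 1) M).Ds →+ (π.sig L M).Ds :=
  ∑ l : Fin (L + 2), (-1 : ℤ) ^ (l : ℕ) •
    (π.sig (L + 1) M).push (π.sig L M) (π.faceY L M l)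

/-- `∂^{s*}_{L,M} = ∑_m (-1)^(L+m) δ_{,m}^{s*}`. -/
noncomputable def dSStar (L M : ℕ) : (π.sig L M).Ds →+ (π.sig L (M + 1)).Ds :=
  ∑ m : Fin (M + 2), (-1 : ℤ) ^ (L + (m : ℕ)) •
    (π.sig L (M + 1)).pull (π.sig L M) (π.faceZ L M m)

end Spaces

end SUBijectivePair

universe u

/-- A first-quadrant double complex of abelian groups, homological in the first and cohomological in
the second index, with anticommuting differentials (entries with a negative index are zero). -/
structure MixedDoubleComplex where
  obj : ℕ → ℕ → AddCommGrpCat.{u}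
  dh : ∀ L M, obj (L + 1) M ⟶ obj L M
  dv : ∀ L M, obj L M ⟶ obj L (M + 1)
  dh_dh : ∀ L M, dh (L + 1) M ≫ dh L M = 0
  dv_dv : ∀ L M, dv L M ≫ dv L (M + 1) = 0
  anticomm : ∀ L M, dh L M ≫ dv L M + dv (L + 1) M ≫ dh L (M + 1) = 0

noncomputable instance : Preadditive (CosimplicialObject AddCommGrpCat.{u}) :=
  inferInstanceAs (Preadditive (SimplexCategory ⥤ AddCommGrpCat.{u}))

theorem sign_aux_zero {C : Type*} [Category C] [Preadditive C] {a b c : C} (f : a ⟶ b) (g : b ⟶ c)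
    (h : f ≫ g = 0) (L : ℕ) : ((-1 : ℤ) ^ L • f) ≫ ((-1 : ℤ) ^ L • g) = 0 := by
  rw [Preadditive.zsmul_comp, Preadditive.comp_zsmul, h, smul_zero, smul_zero]

theorem sign_aux {C : Type*} [Category C] [Preadditive C] {a b c d : C} (f : a ⟶ b) (g : b ⟶ d)
    (f' : a ⟶ c) (g' : c ⟶ d) (h : f ≫ g = f' ≫ g') (L : ℕ) :
    f ≫ ((-1 : ℤ) ^ L • g) + ((-1 : ℤ) ^ (L + 1) • f') ≫ g' = 0 := by
  rw [Preadditive.zsmul_comp, Preadditive.comp_zsmul, h, pow_succ, mul_neg_one, neg_smul,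
    add_neg_cancel]

/-- The unnormalized double complex of a simplicial cosimplicial abelian group: the alternating sums of
faces in the simplicial direction and of cofaces in the cosimplicial direction, the latter multiplied by
`(-1)^L` in column `L` so that the two differentials anticommute. -/
noncomputable def unnormalizedDoubleComplex
    (F : SimplicialObject (CosimplicialObject AddCommGrpCat.{u})) : MixedDoubleComplex.{u} where
  obj L M := (F.obj (op (SimplexCategory.mk L))).obj (SimplexCategory.mk M)
  dh L M := (((AlgebraicTopology.alternatingFaceMapComplex _).obj F).d (L + 1) L).app
    (SimplexCategory.mk M)
  dv L M := (-1 : ℤ) ^ L • ((AlgebraicTopology.alternatingCofaceMapComplex _).obj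
    (F.obj (op (SimplexCategory.mk L)))).d M (M + 1)
  dh_dh L M := by
    have := ((AlgebraicTopology.alternatingFaceMapComplex _).obj F).d_comp_d (L + 2) (L + 1) L
    exact congrArg (fun f => NatTrans.app f (SimplexCategory.mk M)) this
  dv_dv L M := by
    have := ((AlgebraicTopology.alternatingCofaceMapComplex _).obj
      (F.obj (op (SimplexCategory.mk L)))).d_comp_d M (M + 1) (M + 2)
    exact sign_aux_zero _ _ this L
  anticomm L M := by
    have := ((AlgebraicTopology.alternatingCofaceMapComplex _).map
      (((AlgebraicTopology.alternatingFaceMapComplex _).obj F).d (L + 1) L)).comm M (M + 1)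
    exact sign_aux _ _ _ _ this L

namespace SUBijectivePair

section Complex

variable {X Y Z : Type*} [MetricSpace X] [CompactSpace X] [MetricSpace Y] [CompactSpace Y]
  [MetricSpace Z] [CompactSpace Z] {S : SmaleSpace X} (π : SUBijectivePair S Y Z)

/-- `(C_{L,M}, ∂^s, ∂^{s*})` is a double complex. -/
structure IsDoubleComplex : Prop where
  dS_dS : ∀ L M, (π.dS L M).comp (π.dS (L + 1) M) = 0
  dSStar_dSStar : ∀ L M, (π.dSStar L (M + 1)).comp (π.dSStar L M) = 0
  anticomm : ∀ L M,
    (π.dSStar L M).comp (π.dS L M) + (π.dS L (M + 1)).comp (π.dSStar (L + 1) M) = 0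

/-- Putnam's double complex `(C_{L,M}, ∂^s, ∂^{s*})`, `C_{L,M} = D^s(Σ_{L,M}(π))`. -/
noncomputable def putnamComplex (h : π.IsDoubleComplex) : MixedDoubleComplex where
  obj L M := AddCommGrpCat.of (π.sig L M).Ds
  dh L M := AddCommGrpCat.ofHom (π.dS L M)
  dv L M := AddCommGrpCat.ofHom (π.dSStar L M)
  dh_dh L M := by
    apply AddCommGrpCat.hom_ext
    exact h.dS_dS L M
  dv_dv L M := by
    apply AddCommGrpCat.hom_ext
    exact h.dSStar_dSStar L M
  anticomm L M := by
    apply AddCommGrpCat.hom_ext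
    exact h.anticomm L M

end Complex

end SUBijectivePair

/-!
The classes in `D^s` are controlled by unstable correspondences: compact graphs of homeomorphisms
`E → F` between compact open subsets of stable sets that move each point along its local unstable
set. A holonomic pair is joined by such a graph, and `φ⁻¹` contracts the unstable direction, so some
`φ⁻ⁿ` makes the correspondence as small as desired. If the stable topology is totally disconnected,
a small correspondence can be cut into finitely many compact open pieces whose projections lie in
plaques; matching pieces are holonomic, hence `[E] = [F]`. Since `φ` acts injectively on `D^s`, a
function on `CO^s` that is additive and compatible with `φ` therefore factors through `D^s` as soon
as it agrees on the two ends of every small enough correspondence.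

By expansivity an `s`-bijective map is open for the stable topologies, and it sends
correspondences to correspondences; a `u`-bijective map lifts correspondences, and its preimages
of compact open sets are compact and open. This gives `f^s` and `f^{s*}`. In `Σ_{L,M}` the
`z`-coordinates of a point of a stable set determine the `y`-coordinates, because `π_s` is
bijective on stable sets, so the stable topology is totally disconnected and reindexing `y` is
`s`-bijective; dually, reindexing `z` is `u`-bijective. The two kinds of reindexing form pullback
squares of sets, so that images and preimages commute. The rest is formal.
-/

namespace SmaleSpace

open Set Topology

section LocalStructure

variable {X : Type*} [MetricSpace X] [CompactSpace X] (S : SmaleSpace X)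

/-- `y` and `z` are close and lie in the same local stable set. The local unstable relation is
`S.inv.LocallyStable`. -/
def LocallyStable (y z : X) : Prop := dist y z ≤ S.ε ∧ S.bracket y z = z

variable {S}

theorem LocallyStable.dist_le {y z : X} (h : S.LocallyStable y z) : dist y z ≤ S.ε := h.1

theorem LocallyStable.bracket_eq {y z : X} (h : S.LocallyStable y z) : S.bracket y z = z := h.2

theorem LocallyStable.symm {y z : X} (h : S.LocallyStable y z) : S.LocallyStable z y := by
  have hzy : dist z y ≤ S.ε := dist_comm y z ▸ h.dist_le
  have hB3 := S.B3 y z y h.1 (by rwa [h.bracket_eq]) (by simpa using S.ε_pos.le)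
  rw [h.bracket_eq, S.B1] at hB3
  exact ⟨hzy, hB3⟩

theorem LocallyStable.trans {x y z : X} (hxy : S.LocallyStable x y) (hyz : S.LocallyStable y z)
    (hxz : dist x z ≤ S.ε) : S.LocallyStable x z := by
  have hB3 := S.B3 x y z hxy.1 (by rw [hxy.2]; exact hyz.1) hxz
  rw [hxy.bracket_eq, hyz.bracket_eq] at hB3
  exact ⟨hxz, hB3.symm⟩

theorem LocallyStable.map_φ {y z : X} (h : S.LocallyStable y z) :
    S.LocallyStable (S.φ y) (S.φ z) := by
  have hd : dist (S.φ y) (S.φ z) ≤ S.ε :=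
    (S.C1 y z h.1 h.2).trans ((mul_le_of_le_one_left dist_nonneg S.lam_lt_one.le).trans h.1)
  exact ⟨hd, by rw [S.B4 _ _ h.1 hd, h.2]⟩

theorem LocallyStable.of_bracket {x y : X} (h : dist x y ≤ S.ε)
    (h' : dist x (S.bracket x y) ≤ S.ε) : S.LocallyStable x (S.bracket x y) :=
  ⟨h', S.B2 _ _ _ h h' h⟩

theorem LocallyStable.mem_globalStable {y z : X} (h : S.LocallyStable y z) :
    z ∈ S.globalStable y := by
  have hlim := (tendsto_pow_atTop_nhds_zero_of_lt_one S.lam_pos.le S.lam_lt_one).mul_const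
    (dist y z)
  rw [zero_mul] at hlim
  exact squeeze_zero (fun _ => dist_nonneg) (fun n => (S.stable_iterate h.1 h.2 n).1) hlim

theorem LocallyStable.eq_of_inv {x y : X} (hs : S.LocallyStable x y)
    (hu : S.inv.LocallyStable x y) : x = y :=
  hu.symm.bracket_eq.symm.trans hs.bracket_eq

theorem LocallyStable.bracket_eq_of_inv {x y z : X} (hs : S.LocallyStable x y)
    (hu : S.inv.LocallyStable y z) (hxz : dist x z ≤ S.ε) : S.bracket x z = y := by
  have hyz : dist y z ≤ S.ε := hu.dist_le
  have hB3 := S.B3 x y z hs.1 (by rwa [hs.bracket_eq]) hxz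
  rw [hs.bracket_eq] at hB3
  exact hB3.symm.trans hu.symm.bracket_eq

theorem isClosed_setOf_locallyStable : IsClosed {p : X × X | S.LocallyStable p.1 p.2} := by
  have hD : IsClosed {p : X × X | dist p.1 p.2 ≤ S.ε} :=
    isClosed_le continuous_dist continuous_const
  exact (S.continuousOn_bracket.prodMk
    continuous_snd.continuousOn).preimage_isClosed_of_isClosed hD isClosed_diagonal

theorem mem_globalStable_iff_tendsto {x y : X} : y ∈ S.globalStable x ↔ Filter.Tendsto
    (fun n : ℕ => (S.φ^[n] x, S.φ^[n] y)) Filter.atTop (uniformity X) := by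
  rw [tendsto_uniformity_iff_dist_tendsto_zero]
  rfl

theorem mem_globalStable_self (x : X) : x ∈ S.globalStable x := by
  simp [globalStable]

theorem mem_globalStable_symm {x y : X} (h : y ∈ S.globalStable x) : x ∈ S.globalStable y := by
  simpa only [globalStable, mem_ofPred_eq, dist_comm] using h

theorem mem_globalStable_trans {x y z : X} (hxy : y ∈ S.globalStable x)
    (hyz : z ∈ S.globalStable y) : z ∈ S.globalStable x := by
  have hsum := Filter.Tendsto.add hxy hyz
  rw [add_zero] at hsum
  exact squeeze_zero (fun _ => dist_nonneg) (fun n => dist_triangle _ _ _) hsum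

theorem globalStable_eq_of_mem {x y : X} (h : y ∈ S.globalStable x) :
    S.globalStable y = S.globalStable x :=
  Subset.antisymm (fun _ hz => mem_globalStable_trans h hz)
    fun _ hz => mem_globalStable_trans (mem_globalStable_symm h) hz

theorem mem_localStable_iff {x y : X} {δ : ℝ} (hδ : δ ≤ S.ε) :
    y ∈ S.localStable x δ ↔ dist x y < δ ∧ S.LocallyStable x y := by
  refine ⟨fun ⟨hd, hb⟩ => ⟨hd, LocallyStable.symm ⟨?_, hb⟩⟩, fun ⟨hd, h⟩ => ⟨hd, h.symm.2⟩⟩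
  rw [dist_comm]
  exact hd.le.trans hδ

theorem locallyStable_of_mem_localStable {x y z : X} {δ : ℝ} (hδ : δ ≤ S.ε / 2)
    (hy : y ∈ S.localStable x δ) (hz : z ∈ S.localStable x δ) : S.LocallyStable y z := by
  have hε := S.ε_pos
  obtain ⟨hdy, hxy⟩ := (mem_localStable_iff (by linarith)).1 hy
  obtain ⟨hdz, hxz⟩ := (mem_localStable_iff (by linarith)).1 hz
  exact hxy.symm.trans hxz (by linarith [dist_triangle_left y z x])

theorem mem_localStable_self (x : X) {δ : ℝ} (hδ : 0 < δ) : x ∈ S.localStable x δ :=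
  ⟨by rwa [dist_self], S.B1 x⟩

theorem localStable_subset_globalStable {x : X} {δ : ℝ} (hδ : δ ≤ S.ε) :
    S.localStable x δ ⊆ S.globalStable x :=
  fun _ hy => ((mem_localStable_iff hδ).1 hy).2.mem_globalStable

theorem localStable_mono (x : X) {δ δ' : ℝ} (h : δ ≤ δ') :
    S.localStable x δ ⊆ S.localStable x δ' :=
  fun _ hy => ⟨hy.1.trans_le h, hy.2⟩

theorem exists_localStable_subset {x y : X} {δ : ℝ} (hδ : δ ≤ S.ε) (hy : y ∈ S.localStable x δ) :
    ∃ δ' > 0, δ' ≤ S.ε ∧ S.localStable y δ' ⊆ S.localStable x δ := by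
  have hδ' : δ - dist x y ≤ S.ε := (sub_le_self _ dist_nonneg).trans hδ
  refine ⟨δ - dist x y, sub_pos.2 hy.1, hδ', fun w hw => ?_⟩
  obtain ⟨-, hxy⟩ := (mem_localStable_iff hδ).1 hy
  obtain ⟨hdyw, hyw⟩ := (mem_localStable_iff hδ').1 hw
  have hxw : dist x w < δ := by linarith [dist_triangle x y w]
  exact (mem_localStable_iff hδ).2 ⟨hxw, hxy.trans hyw (hxw.le.trans hδ)⟩

theorem isOpen_stableTopology_iff {U : Set X} : IsOpen[S.stableTopology] U ↔
    ∀ x ∈ U, ∃ δ > 0, δ ≤ S.ε ∧ S.localStable x δ ⊆ U := by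
  constructor
  · intro hU
    induction hU with
    | basic s hs =>
      obtain ⟨x, δ, -, hδ, rfl⟩ := hs
      exact fun y hy => exists_localStable_subset hδ hy
    | univ => exact fun x _ => ⟨S.ε, S.ε_pos, le_rfl, subset_univ _⟩
    | inter s t _ _ ihs iht =>
      rintro x ⟨hs, ht⟩
      obtain ⟨a, ha, haε, has⟩ := ihs x hs
      obtain ⟨b, hb, -, hbt⟩ := iht x ht
      exact ⟨min a b, lt_min ha hb, (min_le_left _ _).trans haε, subset_inter
        ((localStable_mono x (min_le_left _ _)).trans has)
        ((localStable_mono x (min_le_right _ _)).trans hbt)⟩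
    | sUnion T _ ih =>
      rintro x ⟨s, hs, hx⟩
      obtain ⟨a, ha, haε, has⟩ := ih s hs x hx
      exact ⟨a, ha, haε, has.trans (subset_sUnion_of_mem hs)⟩
  · intro hU
    let := S.stableTopology
    refine isOpen_iff_forall_mem_open.2 fun x hx => ?_
    obtain ⟨δ, hδ, hδε, hsub⟩ := hU x hx
    exact ⟨_, hsub, TopologicalSpace.isOpen_generateFrom_of_mem ⟨x, δ, hδ, hδε, rfl⟩,
      mem_localStable_self x hδ⟩

theorem isOpen_localStable (x : X) {δ : ℝ} (hδ : δ ≤ S.ε) :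
    IsOpen[S.stableTopology] (S.localStable x δ) :=
  isOpen_stableTopology_iff.2 fun _ hy => exists_localStable_subset hδ hy

theorem stableTopology_le : S.stableTopology ≤ (inferInstance : TopologicalSpace X) := by
  refine fun U hU => isOpen_stableTopology_iff.2 fun x hx => ?_
  obtain ⟨δ, hδ, hball⟩ := Metric.isOpen_iff.1 hU x hx
  refine ⟨min δ S.ε, lt_min hδ S.ε_pos, min_le_right _ _, fun y hy => hball ?_⟩
  rw [Metric.mem_ball']
  exact hy.1.trans_le (min_le_left _ _)

theorem t2Space_stableTopology : @T2Space X S.stableTopology :=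
  @T2Space.of_injective_continuous X X S.stableTopology _ _ id Function.injective_id
    (continuous_id_of_le stableTopology_le)

theorem isOpen_globalStable (x : X) : IsOpen[S.stableTopology] (S.globalStable x) :=
  isOpen_stableTopology_iff.2 fun _ hy => ⟨S.ε, S.ε_pos, le_rfl, fun _ hz =>
    mem_globalStable_trans hy (localStable_subset_globalStable le_rfl hz)⟩

theorem isClosed_globalStable (x : X) : IsClosed[S.stableTopology] (S.globalStable x) := by
  let := S.stableTopology
  rw [← isOpen_compl_iff, isOpen_stableTopology_iff]
  exact fun y hy => ⟨S.ε, S.ε_pos, le_rfl, fun z hz hz' => hy (mem_globalStable_trans hz'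
    (mem_globalStable_symm (localStable_subset_globalStable le_rfl hz)))⟩

end LocalStructure

section CompactOpen

variable {X : Type*} [MetricSpace X] [CompactSpace X] (S : SmaleSpace X)

/-- Points of `E` that are close in the metric lie in the same local stable set; equivalently, the
metric and the stable topology agree on `E`, uniformly. -/
def Flat (E : Set X) : Prop := ∃ δ > 0, ∀ x ∈ E, ∀ y ∈ E, dist x y ≤ δ → S.LocallyStable x y

variable {S}

theorem isCompact_of_stableTopology {E : Set X} (h : @IsCompact X S.stableTopology E) :
    IsCompact E := by
  simpa only [image_id] using
    @IsCompact.image X X S.stableTopology _ E id h (continuous_id_of_le stableTopology_le)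

theorem flat_of_isCompact_stableTopology {E : Set X} (h : @IsCompact X S.stableTopology E) :
    S.Flat E := by
  have hε := S.ε_pos
  -- A Lebesgue number of the cover by the metrically open sets that miss the part of `E` off one
  -- plaque.
  have hopen (x : X) : IsOpen (E \ S.localStable x (S.ε / 2))ᶜ :=
    (isCompact_of_stableTopology (@IsCompact.diff X S.stableTopology E _ h
      (isOpen_localStable x (by linarith)))).isClosed.isOpen_compl
  obtain ⟨δ, hδ, hball⟩ := lebesgue_number_lemma_of_metric (isCompact_of_stableTopology h) hopen
    fun x _ => mem_iUnion.2 ⟨x, fun hx => hx.2 (mem_localStable_self x (by linarith))⟩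
  refine ⟨δ / 2, by linarith, fun x hx y hy hxy => ?_⟩
  obtain ⟨w, hw⟩ := hball x hx
  have hplaque : ∀ z ∈ E, dist z x < δ → z ∈ S.localStable w (S.ε / 2) :=
    fun z hz hzx => not_not.1 fun hmem => hw (Metric.mem_ball.2 hzx) ⟨hz, hmem⟩
  exact locallyStable_of_mem_localStable le_rfl (hplaque x hx (by rwa [dist_self]))
    (hplaque y hy (by rw [dist_comm]; linarith))

theorem Flat.continuousOn_id {E : Set X} (h : S.Flat E) :
    @ContinuousOn X X _ S.stableTopology id E := by
  obtain ⟨δ, hδ, hclose⟩ := h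
  refine fun x hx => Filter.tendsto_def.2 fun U hU => ?_
  obtain ⟨V, hVU, hV, hxV⟩ := (@mem_nhds_iff X S.stableTopology x U).1 hU
  obtain ⟨η, hη, hηε, hηV⟩ := isOpen_stableTopology_iff.1 hV x hxV
  rw [Metric.mem_nhdsWithin_iff]
  refine ⟨min δ η, lt_min hδ hη, ?_⟩
  rintro y ⟨hy, hyE⟩
  rw [Metric.mem_ball'] at hy
  exact hVU (hηV ((mem_localStable_iff hηε).2 ⟨hy.trans_le (min_le_right _ _),
    hclose x hx y hyE (hy.le.trans (min_le_left _ _))⟩))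

theorem isCompact_stableTopology_iff {E : Set X} :
    @IsCompact X S.stableTopology E ↔ IsCompact E ∧ S.Flat E := by
  refine ⟨fun h => ⟨isCompact_of_stableTopology h, flat_of_isCompact_stableTopology h⟩, fun h => ?_⟩
  simpa only [image_id] using
    @IsCompact.image_of_continuousOn X X _ S.stableTopology E id h.1 h.2.continuousOn_id

variable (S) in
/-- `W` is compact and open in the stable topology of `X`. Unlike a member of `CO^s` it may meet
several stable sets, as preimages under `u`-bijective maps do. -/
def IsCompactOpen (W : Set X) : Prop :=
  @IsCompact X S.stableTopology W ∧ IsOpen[S.stableTopology] W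

theorem CO.isCompactOpen (E : S.CO) : S.IsCompactOpen E.1 := E.2.2

namespace IsCompactOpen

variable {V W : Set X}

theorem isCompact (hW : S.IsCompactOpen W) : IsCompact W := isCompact_of_stableTopology hW.1

theorem isClosed (hW : S.IsCompactOpen W) : IsClosed[S.stableTopology] W :=
  @IsCompact.isClosed X S.stableTopology t2Space_stableTopology W hW.1

theorem inter (hV : S.IsCompactOpen V) (hW : S.IsCompactOpen W) : S.IsCompactOpen (V ∩ W) :=
  ⟨@IsCompact.inter_right X S.stableTopology _ _ hV.1 hW.isClosed,
    @IsOpen.inter X S.stableTopology _ _ hV.2 hW.2⟩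

theorem sdiff (hV : S.IsCompactOpen V) (hW : S.IsCompactOpen W) : S.IsCompactOpen (V \ W) :=
  ⟨@IsCompact.diff X S.stableTopology V W hV.1 hW.2,
    @IsOpen.sdiff X V W S.stableTopology hV.2 hW.isClosed⟩

theorem inter_globalStable (hW : S.IsCompactOpen W) (x : X) :
    S.IsCompactOpen (W ∩ S.globalStable x) :=
  ⟨@IsCompact.inter_right X S.stableTopology W _ hW.1 (isClosed_globalStable x),
    @IsOpen.inter X S.stableTopology W _ hW.2 (isOpen_globalStable x)⟩

theorem of_isClosed (hW : S.IsCompactOpen W) (hVW : V ⊆ W) (hV : IsClosed V)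
    (hdiff : IsClosed (W \ V)) : S.IsCompactOpen V := by
  have hcompact : ∀ C ⊆ W, IsClosed C → @IsCompact X S.stableTopology C := fun C hCW hC =>
    @IsCompact.of_isClosed_subset X S.stableTopology W C hW.1 (hC.mono stableTopology_le) hCW
  refine ⟨hcompact V hVW hV, ?_⟩
  rw [← sdiff_sdiff_cancel_left hVW]
  exact @IsOpen.sdiff X W _ S.stableTopology hW.2
    (@IsCompact.isClosed X S.stableTopology t2Space_stableTopology _
      (hcompact _ sdiff_subset hdiff))

theorem of_iUnion_eq {ι : Type*} [Finite ι] {V : ι → Set X} (hW : S.IsCompactOpen W)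
    (hV : ∀ i, IsClosed (V i)) (hdisj : ∀ i j, i ≠ j → Disjoint (V i) (V j))
    (hunion : ⋃ i, V i = W) (i : ι) : S.IsCompactOpen (V i) := by
  have hrest : W \ V i = ⋃ j : {j // j ≠ i}, V j := by
    rw [← hunion]
    ext x
    simp only [mem_sdiff, mem_iUnion, Subtype.exists, exists_prop]
    refine ⟨fun ⟨⟨j, hj⟩, hi⟩ => ⟨j, fun hji => hi (hji ▸ hj), hj⟩, fun ⟨j, hji, hj⟩ =>
      ⟨⟨j, hj⟩, disjoint_left.1 (hdisj j i hji) hj⟩⟩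
  refine hW.of_isClosed (hunion ▸ subset_iUnion V i) (hV i) ?_
  rw [hrest]
  exact isClosed_iUnion_of_finite fun j => hV j

end IsCompactOpen

end CompactOpen

section Partitions

variable {X : Type*} [MetricSpace X] [CompactSpace X] {S : SmaleSpace X}

theorem disjoint_globalStable_of_ne {x y : X} (h : S.globalStable x ≠ S.globalStable y) :
    Disjoint (S.globalStable x) (S.globalStable y) :=
  disjoint_left.2 fun _ hx hy =>
    h ((globalStable_eq_of_mem hx).symm.trans (globalStable_eq_of_mem hy))

variable (S) in
/-- `P` is a partition of `W` into members of `CO^s`; `IsPreimagePartition` is the case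
`W = f ⁻¹' E`. -/
def IsPartition (W : Set X) {ι : Type*} (P : ι → S.CO) : Prop :=
  (∀ i j, i ≠ j → Disjoint (P i).1 (P j).1) ∧ ⋃ i, (P i).1 = W

theorem IsCompactOpen.exists_isPartition {W : Set X} (hW : S.IsCompactOpen W) :
    ∃ (n : ℕ) (P : Fin n → S.CO), S.IsPartition W P := by
  classical
  obtain ⟨t, ht⟩ := @IsCompact.elim_finite_subcover X S.stableTopology W X hW.1 S.globalStable
    isOpen_globalStable fun x _ => mem_iUnion.2 ⟨x, mem_globalStable_self x⟩
  let T := t.image S.globalStable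
  let e := T.equivFin
  choose x hx using fun ℓ : T => (Finset.mem_image.1 ℓ.2).imp fun _ h => h.2
  refine ⟨_, fun i => ⟨W ∩ S.globalStable (x (e.symm i)), ⟨_, inter_subset_right⟩,
    hW.inter_globalStable _⟩, fun i j hij => ?_, ?_⟩
  · refine (disjoint_globalStable_of_ne fun h => hij ?_).mono inter_subset_right inter_subset_right
    exact e.symm.injective (Subtype.ext ((hx _).symm.trans (h.trans (hx _))))
  · refine Subset.antisymm (iUnion_subset fun i => inter_subset_left) fun z hz => ?_
    obtain ⟨y, hy, hzy⟩ := mem_iUnion₂.1 (ht hz)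
    refine mem_iUnion.2 ⟨e ⟨_, Finset.mem_image_of_mem _ hy⟩, hz, ?_⟩
    rwa [hx, e.symm_apply_apply]

theorem cls_eq_of_rel {E F : S.CO} (h : S.Rel E F) : S.cls E = S.cls F :=
  congrArg (fun q => (QuotientAddGroup.mk (FreeAbelianGroup.of q) : S.Ds)) (Quotient.sound h)

theorem cls_union {E F G : S.CO} (hd : Disjoint E.1 F.1) (hG : G.1 = E.1 ∪ F.1) :
    S.cls G = S.cls E + S.cls F := by
  have hmem : S.freeCls G - S.freeCls E - S.freeCls F ∈ S.additivity :=
    AddSubgroup.subset_closure ⟨E, F, G, hd, hG, rfl⟩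
  have hzero := (QuotientAddGroup.eq_zero_iff _).2 hmem
  rwa [QuotientAddGroup.mk_sub, QuotientAddGroup.mk_sub, sub_sub, sub_eq_zero] at hzero

theorem cls_eq_zero_of_eq_empty {E : S.CO} (h : E.1 = ∅) : S.cls E = 0 := by
  simpa using cls_union (E := E) (F := E) (G := E) (by simp [h]) (by simp)

/-- The compact open subset `V` of the stable set containing `E`. -/
def CO.restrict (E : S.CO) (V : Set X) (hV : S.IsCompactOpen V) (hVE : V ⊆ E.1) : S.CO :=
  ⟨V, E.2.1.imp fun _ he => hVE.trans he, hV⟩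

/-- The intersection of two members of `CO^s`, as a member of `CO^s`. -/
def CO.inter (E F : S.CO) : S.CO :=
  E.restrict (E.1 ∩ F.1) (E.isCompactOpen.inter F.isCompactOpen) inter_subset_left

theorem CO.inter_comm (E F : S.CO) : E.inter F = F.inter E :=
  Subtype.ext (Set.inter_comm E.1 F.1)

theorem cls_eq_sum_finset {ι : Type*} (P : ι → S.CO) (s : Finset ι)
    (hdisj : ∀ i ∈ s, ∀ j ∈ s, i ≠ j → Disjoint (P i).1 (P j).1) (E : S.CO)
    (hE : E.1 = ⋃ i ∈ s, (P i).1) : S.cls E = ∑ i ∈ s, S.cls (P i) := by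
  classical
  induction s using Finset.induction_on generalizing E with
  | empty => rw [Finset.sum_empty, cls_eq_zero_of_eq_empty (by simpa using hE)]
  | insert a s ha ih =>
    rw [Finset.set_biUnion_insert] at hE
    have hd : Disjoint (P a).1 (⋃ i ∈ s, (P i).1) := disjoint_iUnion₂_right.2 fun i hi =>
      hdisj a (Finset.mem_insert_self _ _) i (Finset.mem_insert_of_mem hi) fun h => ha (h ▸ hi)
    have hrest : (⋃ i ∈ s, (P i).1) = E.1 \ (P a).1 := by
      rw [hE, union_sdiff_left, hd.symm.sdiff_eq_left]
    let E' := E.restrict (⋃ i ∈ s, (P i).1) (hrest ▸ E.isCompactOpen.sdiff (P a).isCompactOpen)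
      (hE ▸ subset_union_right)
    rw [Finset.sum_insert ha, cls_union (E := P a) (F := E') hd hE, ih _ E' rfl]
    exact fun i hi j hj => hdisj i (Finset.mem_insert_of_mem hi) j (Finset.mem_insert_of_mem hj)

namespace IsPartition

variable {W : Set X} {ι κ : Type*}

theorem subset {P : ι → S.CO} (hP : S.IsPartition W P) (i : ι) : (P i).1 ⊆ W :=
  hP.2 ▸ subset_iUnion (fun i => (P i).1) i

theorem cls_eq_sum [Fintype ι] {P : ι → S.CO} {E : S.CO} (hP : S.IsPartition E.1 P) :
    S.cls E = ∑ i, S.cls (P i) :=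
  cls_eq_sum_finset P Finset.univ (fun i _ j _ => hP.1 i j) E (by simpa using hP.2.symm)

theorem inter {P : ι → S.CO} (hP : S.IsPartition W P) (E : S.CO) (hE : E.1 ⊆ W) :
    S.IsPartition E.1 fun i => E.inter (P i) := by
  refine ⟨fun i j hij => (hP.1 i j hij).mono inter_subset_right inter_subset_right, ?_⟩
  change ⋃ i, E.1 ∩ (P i).1 = E.1
  rwa [← inter_iUnion, hP.2, inter_eq_left]

theorem sum_cls_eq_sum_cls [Fintype ι] [Fintype κ] {P : ι → S.CO} {Q : κ → S.CO}
    (hP : S.IsPartition W P) (hQ : S.IsPartition W Q) :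
    ∑ i, S.cls (P i) = ∑ j, S.cls (Q j) := by
  calc ∑ i, S.cls (P i)
      = ∑ i, ∑ j, S.cls ((P i).inter (Q j)) :=
        Finset.sum_congr rfl fun i _ => (hQ.inter (P i) (hP.subset i)).cls_eq_sum
    _ = ∑ j, ∑ i, S.cls ((Q j).inter (P i)) := by
        rw [Finset.sum_comm]
        simp only [CO.inter_comm]
    _ = ∑ j, S.cls (Q j) :=
        Finset.sum_congr rfl fun j _ => (hP.inter (Q j) (hQ.subset j)).cls_eq_sum.symm

theorem sigma {κ : ι → Type*} {V : ι → Set X} {Q : (i : ι) → κ i → S.CO}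
    (hdisj : ∀ i j, i ≠ j → Disjoint (V i) (V j)) (hunion : ⋃ i, V i = W)
    (hQ : ∀ i, S.IsPartition (V i) (Q i)) :
    S.IsPartition W (fun x : Σ i, κ i => Q x.1 x.2) := by
  constructor
  · rintro ⟨i, k⟩ ⟨j, l⟩ hne
    rcases eq_or_ne i j with rfl | hij
    · exact (hQ i).1 k l fun hkl => hne (by rw [hkl])
    · exact (hdisj i j hij).mono ((hQ i).subset k) ((hQ j).subset l)
  · rw [iUnion_sigma, ← hunion]
    exact iUnion_congr fun i => (hQ i).2

end IsPartition

/-- The class in `D^s` of a compact open set, which need not lie in one stable set: the sum of the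
classes of the pieces of any partition into members of `CO^s`. -/
noncomputable def IsCompactOpen.cls {W : Set X} (hW : S.IsCompactOpen W) : S.Ds :=
  ∑ i, S.cls (hW.exists_isPartition.choose_spec.choose i)

theorem IsPartition.sum_cls {W : Set X} {ι : Type*} [Fintype ι] {P : ι → S.CO}
    (hP : S.IsPartition W P) (hW : S.IsCompactOpen W) : ∑ i, S.cls (P i) = hW.cls :=
  hP.sum_cls_eq_sum_cls hW.exists_isPartition.choose_spec.choose_spec

theorem CO.cls_isCompactOpen (E : S.CO) : E.isCompactOpen.cls = S.cls E := by
  have hE : S.IsPartition E.1 fun _ : Unit => E :=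
    ⟨fun _ _ hij => (hij rfl).elim, iUnion_const _⟩
  rw [hE.cls_eq_sum, hE.sum_cls E.isCompactOpen]

namespace IsCompactOpen

variable {V W : Set X}

theorem cls_eq_cls (hV : S.IsCompactOpen V) (E : S.CO) (h : E.1 = V) : hV.cls = S.cls E := by
  subst h
  exact E.cls_isCompactOpen

theorem cls_iUnion {ι : Type*} [Fintype ι] {V : ι → Set X} (hV : ∀ i, S.IsCompactOpen (V i))
    (hdisj : ∀ i j, i ≠ j → Disjoint (V i) (V j)) (hunion : ⋃ i, V i = W)
    (hW : S.IsCompactOpen W) : hW.cls = ∑ i, (hV i).cls := by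
  choose n P hP using fun i => (hV i).exists_isPartition
  rw [← (IsPartition.sigma hdisj hunion hP).sum_cls hW, Fintype.sum_sigma]
  exact Finset.sum_congr rfl fun i _ => (hP i).sum_cls (hV i)

theorem cls_union {U : Set X} (hU : S.IsCompactOpen U) (hV : S.IsCompactOpen V)
    (hW : S.IsCompactOpen W) (hdisj : Disjoint U V) (hunion : W = U ∪ V) :
    hW.cls = hU.cls + hV.cls := by
  rw [cls_iUnion (V := fun b => cond b U V) (Bool.forall_bool.2 ⟨hV, hU⟩) _ _ hW,
    Fintype.sum_bool]
  · rintro (_ | _) (_ | _) hne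
    exacts [(hne rfl).elim, hdisj.symm, hdisj, (hne rfl).elim]
  · rw [← union_eq_iUnion, hunion]

end IsCompactOpen

theorem Ds_hom_ext {G : Type*} [AddCommGroup G] {g h : S.Ds →+ G}
    (hgh : ∀ E, g (S.cls E) = h (S.cls E)) : g = h := by
  apply QuotientAddGroup.addMonoidHom_ext
  apply FreeAbelianGroup.lift_ext
  intro q
  induction q using Quotient.inductionOn with
  | _ E => exact hgh E

theorem exists_Ds_hom {G : Type*} [AddCommGroup G] (c : S.CO → G)
    (hrel : ∀ E F, S.Rel E F → c E = c F)
    (hadd : ∀ E F H : S.CO, Disjoint E.1 F.1 → H.1 = E.1 ∪ F.1 → c H = c E + c F) :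
    ∃ g : S.Ds →+ G, ∀ E, g (S.cls E) = c E := by
  let g₀ : FreeAbelianGroup (Quotient S.relSetoid) →+ G :=
    FreeAbelianGroup.lift (Quotient.lift c hrel)
  have hg₀ : ∀ E, g₀ (S.freeCls E) = c E := fun E => FreeAbelianGroup.lift_apply_of _ _
  refine ⟨QuotientAddGroup.lift S.additivity g₀ ?_, hg₀⟩
  rw [additivity, AddSubgroup.closure_le]
  rintro _ ⟨E, F, H, hdisj, hH, rfl⟩
  change g₀ _ = 0
  rw [map_sub, map_sub, hg₀, hg₀, hg₀, hadd E F H hdisj hH, sub_sub, sub_self]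

end Partitions

section Maps

variable {A B : Type*} [MetricSpace A] [CompactSpace A] [MetricSpace B] [CompactSpace B]
  {S : SmaleSpace A} {T : SmaleSpace B} {f : A → B}

namespace IsMap

theorem uniformContinuous (hf : S.IsMap T f) : UniformContinuous f :=
  CompactSpace.uniformContinuous_of_continuous hf.1

theorem iterate (hf : S.IsMap T f) (n : ℕ) (x : A) : f (S.φ^[n] x) = T.φ^[n] (f x) :=
  Function.Semiconj.iterate_right (f := f) (ga := S.φ) (gb := T.φ) hf.2 n x

theorem inv (hf : S.IsMap T f) : S.inv.IsMap T.inv f := by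
  refine ⟨hf.1, fun x => T.φ.injective ?_⟩
  change T.φ (f (S.φ.symm x)) = T.φ (T.φ.symm (f x))
  rw [← hf.2, S.φ.apply_symm_apply, T.φ.apply_symm_apply]

theorem mem_globalStable (hf : S.IsMap T f) {x y : A} (h : y ∈ S.globalStable x) :
    f y ∈ T.globalStable (f x) := by
  rw [mem_globalStable_iff_tendsto] at h ⊢
  simp only [← hf.iterate]
  exact Filter.Tendsto.comp hf.uniformContinuous h

theorem image_image_φ (hf : S.IsMap T f) (E : Set A) : f '' (S.φ '' E) = T.φ '' (f '' E) :=
  image_comm hf.2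

theorem preimage_image_φ (hf : S.IsMap T f) (E : Set B) :
    f ⁻¹' (T.φ '' E) = S.φ '' (f ⁻¹' E) := by
  rw [T.φ.image_eq_preimage_symm, S.φ.image_eq_preimage_symm, ← preimage_comp, ← preimage_comp]
  exact congrArg (· ⁻¹' E) (funext fun x => (hf.inv.2 x).symm)

theorem exists_locallyStable_map (hf : S.IsMap T f) :
    ∃ δ > 0, δ ≤ S.ε ∧
      ∀ x y, dist x y < δ → S.LocallyStable x y → T.LocallyStable (f x) (f y) := by
  obtain ⟨δ, hδ, hδε, hbracket⟩ := S.exists_bracket_map T hf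
  obtain ⟨δ', hδ', hdist⟩ := Metric.uniformContinuous_iff.1 hf.uniformContinuous T.ε T.ε_pos
  refine ⟨min δ δ', lt_min hδ hδ', (min_le_left _ _).trans hδε, fun x y hd hxy =>
    ⟨(hdist (hd.trans_le (min_le_right _ _))).le, ?_⟩⟩
  rw [← hbracket _ _ (hd.le.trans (min_le_left _ _)), hxy.bracket_eq]

theorem isOpen_preimage (hf : S.IsMap T f) {U : Set B} (hU : IsOpen[T.stableTopology] U) :
    IsOpen[S.stableTopology] (f ⁻¹' U) := by
  rw [isOpen_stableTopology_iff] at hU ⊢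
  intro x hx
  obtain ⟨η, hη, hηε, hsub⟩ := hU _ hx
  obtain ⟨δ, hδ, hδε, hstable⟩ := hf.exists_locallyStable_map
  obtain ⟨δ', hδ', hdist⟩ := Metric.uniformContinuous_iff.1 hf.uniformContinuous η hη
  refine ⟨min δ δ', lt_min hδ hδ', (min_le_left _ _).trans hδε, fun y hy => hsub ?_⟩
  rw [mem_localStable_iff ((min_le_left _ _).trans hδε), lt_min_iff] at hy
  exact (mem_localStable_iff hηε).2 ⟨hdist hy.1.2, hstable _ _ hy.1.1 hy.2⟩

theorem continuous_stableTopology (hf : S.IsMap T f) :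
    @Continuous A B S.stableTopology T.stableTopology f :=
  (@continuous_def A B S.stableTopology T.stableTopology f).2 fun _ => hf.isOpen_preimage

theorem isCompact_image (hf : S.IsMap T f) {V : Set A}
    (hV : @IsCompact A S.stableTopology V) : @IsCompact B T.stableTopology (f '' V) :=
  @IsCompact.image A B S.stableTopology T.stableTopology V f hV hf.continuous_stableTopology

end IsMap

theorem isMap_φ (S : SmaleSpace A) : S.IsMap S S.φ := ⟨S.φ.continuous, fun _ => rfl⟩

theorem isMap_φ_symm (S : SmaleSpace A) : S.IsMap S S.φ.symm :=
  ⟨S.φ.symm.continuous, fun x => by rw [S.φ.symm_apply_apply, S.φ.apply_symm_apply]⟩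

theorem sBijective_of_inverse {g : B → A} (hf : S.IsMap T f) (hg : T.IsMap S g)
    (hgf : Function.LeftInverse g f) (hfg : Function.RightInverse g f) : S.SBijective T f := by
  refine fun x => InvOn.bijOn ⟨hgf.leftInvOn _, hfg.rightInvOn _⟩
    (fun y hy => hf.mem_globalStable hy) fun y hy => ?_
  simpa only [hgf x] using hg.mem_globalStable hy

theorem sBijective_φ (S : SmaleSpace A) : S.SBijective S S.φ :=
  sBijective_of_inverse S.isMap_φ S.isMap_φ_symm S.φ.left_inv S.φ.right_inv

theorem sBijective_φ_symm (S : SmaleSpace A) : S.SBijective S S.φ.symm :=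
  sBijective_of_inverse S.isMap_φ_symm S.isMap_φ S.φ.right_inv S.φ.left_inv

end Maps

section Expansivity

variable {A B : Type*} [MetricSpace A] [CompactSpace A] [MetricSpace B] [CompactSpace B]
  {S : SmaleSpace A} {T : SmaleSpace B} {f : A → B}

theorem exists_locallyStable_of_iterate (S : SmaleSpace A) :
    ∃ δ > 0, ∀ a b, (∀ n : ℕ, dist (S.φ^[n] a) (S.φ^[n] b) ≤ δ) → S.LocallyStable a b := by
  obtain ⟨δ, hδ, hδε, hshadow⟩ := S.exists_shadow
  exact ⟨δ, hδ, fun a b hab => ⟨(hab 0).trans hδε, hshadow b a hab⟩⟩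

theorem exists_dist_lt_of_dist_map_lt {B : Type*} [MetricSpace B] {f : A → B} (hf : Continuous f)
    (hinj : ∀ x, InjOn f (S.globalStable x)) {c : ℝ} (hc : 0 < c) :
    ∃ η > 0, ∀ a b, S.LocallyStable a b → dist (f a) (f b) < η → dist a b < c := by
  have hK : IsCompact ({p : A × A | S.LocallyStable p.1 p.2} ∩ {p | c ≤ dist p.1 p.2}) :=
    (isClosed_setOf_locallyStable.inter (isClosed_le continuous_const continuous_dist)).isCompact
  obtain ⟨η, hη, hηK⟩ := hK.exists_forall_le' (f := fun p => dist (f p.1) (f p.2)) (a := 0)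
    (by fun_prop) (by
      rintro ⟨a, b⟩ ⟨hab, hcab⟩
      refine dist_pos.2 fun hfab => hc.not_ge ?_
      obtain rfl : a = b := hinj a (mem_globalStable_self a) hab.mem_globalStable hfab
      simpa using hcab)
  exact ⟨η, hη, fun a b hab hfab => not_le.1 fun hcab => (hηK (a, b) ⟨hab, hcab⟩).not_gt hfab⟩

/-- Expansivity: two points of a stable set are eventually close, and going backwards in
time they cannot become distant as long as their images stay close. -/
theorem IsMap.exists_locallyStable_of_map (hf : S.IsMap T f)
    (hinj : ∀ x, InjOn f (S.globalStable x)) {c : ℝ} (hc : 0 < c) :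
    ∃ η > 0, ∀ y y', y' ∈ S.globalStable y → T.LocallyStable (f y) (f y') →
      dist (f y) (f y') < η → dist y y' < c ∧ S.LocallyStable y y' := by
  obtain ⟨δ, hδ, hstable⟩ := S.exists_locallyStable_of_iterate
  obtain ⟨γ, hγ, hback⟩ := Metric.uniformContinuous_iff.1 S.isMap_φ_symm.uniformContinuous δ hδ
  obtain ⟨c', hc', hc'c, hc'γ, hc'δ⟩ : ∃ c' > 0, c' ≤ c ∧ c' ≤ γ ∧ c' ≤ δ :=
    ⟨min c (min γ δ), lt_min hc (lt_min hγ hδ), min_le_left _ _,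
      (min_le_right _ _).trans (min_le_left _ _), (min_le_right _ _).trans (min_le_right _ _)⟩
  obtain ⟨η, hη, hclose⟩ := exists_dist_lt_of_dist_map_lt hf.1 hinj hc'
  refine ⟨η, hη, fun y y' hy hfy hd => ?_⟩
  have hstable_at (n : ℕ) (hn : ∀ m ≥ n, dist (S.φ^[m] y) (S.φ^[m] y') ≤ δ) :
      S.LocallyStable (S.φ^[n] y) (S.φ^[n] y') := hstable _ _ fun k => by
    rw [← Function.iterate_add_apply, ← Function.iterate_add_apply]
    exact hn _ (Nat.le_add_left n k)
  obtain ⟨N, hN⟩ := Metric.tendsto_atTop.1 hy c' hc'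
  simp only [Real.dist_0_eq_abs, abs_of_nonneg dist_nonneg] at hN
  have hall : ∀ n ≤ N, ∀ m ≥ n, dist (S.φ^[m] y) (S.φ^[m] y') < c' := by
    intro n hn
    induction hn using Nat.decreasingInduction with
    | self => exact hN
    | of_succ n _ ih =>
      suffices hn : dist (S.φ^[n] y) (S.φ^[n] y') < c' from fun m hm =>
        (Nat.eq_or_lt_of_le hm).elim (fun h => h ▸ hn) (ih m)
      have hδn : dist (S.φ^[n] y) (S.φ^[n] y') < δ := by
        have hsucc := hback ((ih (n + 1) le_rfl).trans_le hc'γ)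
        simpa only [Function.iterate_succ_apply', S.φ.symm_apply_apply] using hsucc
      refine hclose _ _ (hstable_at n fun m hm => ?_) ?_
      · exact (Nat.eq_or_lt_of_le hm).elim (fun h => h ▸ hδn.le)
          fun h => (ih m h).le.trans hc'δ
      · rw [hf.iterate, hf.iterate]
        exact (T.stable_iterate_le hfy.1 hfy.2 n).trans_lt hd
  have hzero := hall 0 (Nat.zero_le N)
  exact ⟨(hzero 0 le_rfl).trans_le hc'c, hstable_at 0 fun m hm => (hzero m hm).le.trans hc'δ⟩

theorem SBijective.isOpen_image (hb : S.SBijective T f) (hf : S.IsMap T f) {V : Set A}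
    (hV : IsOpen[S.stableTopology] V) : IsOpen[T.stableTopology] (f '' V) := by
  rw [isOpen_stableTopology_iff] at hV ⊢
  rintro _ ⟨x, hx, rfl⟩
  obtain ⟨c, hc, hcε, hsub⟩ := hV x hx
  obtain ⟨η, hη, hclose⟩ := hf.exists_locallyStable_of_map (fun x => (hb x).injOn) hc
  refine ⟨min η T.ε, lt_min hη T.ε_pos, min_le_right _ _, fun y hy => ?_⟩
  rw [mem_localStable_iff (min_le_right _ _), lt_min_iff] at hy
  obtain ⟨x', hx', rfl⟩ := (hb x).surjOn hy.2.mem_globalStable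
  exact ⟨x', hsub ((mem_localStable_iff hcε).2 (hclose x x' hx' hy.2 hy.1.1)), rfl⟩

theorem IsMap.flat_preimage (hf : S.IsMap T f) (hinj : ∀ x, InjOn f (S.globalUnstable x))
    {E : Set B} (hE : T.Flat E) : S.Flat (f ⁻¹' E) := by
  obtain ⟨δ, hδ, hflat⟩ := hE
  obtain ⟨δ₁, hδ₁, hδ₁ε, hbracket⟩ := S.exists_bracket_map T hf
  obtain ⟨δ₂, hδ₂, -, hnear⟩ := S.bracket_near S.ε_pos
  obtain ⟨δ₃, hδ₃, hdist⟩ := Metric.uniformContinuous_iff.1 hf.uniformContinuous δ hδ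
  refine ⟨min (min δ₁ δ₂) (δ₃ / 2), lt_min (lt_min hδ₁ hδ₂) (half_pos hδ₃), ?_⟩
  intro a ha a' ha' hd
  obtain ⟨⟨hd₁, hd₂⟩, hd₃⟩ := (le_min_iff.1 hd).imp_left le_min_iff.1
  obtain ⟨hwa, hwa'⟩ := hnear a a' hd₂
  have hstable : S.LocallyStable a (S.bracket a a') :=
    LocallyStable.of_bracket (hd₁.trans hδ₁ε) (by rw [dist_comm]; exact hwa.le)
  have hunstable : S.inv.LocallyStable a' (S.bracket a a') :=
    LocallyStable.of_bracket (S := S.inv) (by rw [dist_comm]; exact hd₁.trans hδ₁ε)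
      (by rw [dist_comm]; exact hwa'.le)
  have hmap : f (S.bracket a a') = f a' := by
    rw [hbracket a a' hd₁]
    exact (hflat _ ha _ ha' (hdist (hd₃.trans_lt (half_lt_self hδ₃))).le).bracket_eq
  rwa [hinj a' hunstable.mem_globalStable (mem_globalStable_self (S := S.inv) a') hmap] at hstable

theorem IsCompactOpen.preimage {E : Set B} (hE : T.IsCompactOpen E) (hf : S.IsMap T f)
    (hinj : ∀ x, InjOn f (S.globalUnstable x)) : S.IsCompactOpen (f ⁻¹' E) := by
  obtain ⟨hcompact, hflat⟩ := isCompact_stableTopology_iff.1 hE.1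
  exact ⟨isCompact_stableTopology_iff.2 ⟨(hcompact.isClosed.preimage hf.1).isCompact,
    hf.flat_preimage hinj hflat⟩, hf.isOpen_preimage hE.2⟩

theorem IsCompactOpen.image {V : Set A} (hV : S.IsCompactOpen V) (hf : S.IsMap T f)
    (hb : S.SBijective T f) : T.IsCompactOpen (f '' V) :=
  ⟨hf.isCompact_image hV.1, hb.isOpen_image hf hV.2⟩

/-- The image of a member of `CO^s` under an `s`-bijective map. -/
def CO.image (E : S.CO) (hf : S.IsMap T f) (hb : S.SBijective T f) : T.CO :=
  ⟨f '' E.1, E.2.1.elim fun e he => ⟨f e, ((hb e).mapsTo.mono_left he).image_subset⟩,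
    E.isCompactOpen.image hf hb⟩

theorem CO.injOn {B : Type*} {f : A → B} (E : S.CO) (hinj : ∀ x, InjOn f (S.globalStable x)) :
    InjOn f E.1 :=
  E.2.1.elim fun e he => (hinj e).mono he

end Expansivity

section Shift

variable {A : Type*} [MetricSpace A] [CompactSpace A] {S : SmaleSpace A}

/-- The action of `φ` on `CO^s`. -/
def CO.φ (E : S.CO) : S.CO := E.image S.isMap_φ S.sBijective_φ

/-- The action of `φ⁻¹` on `CO^s`. -/
def CO.φ_symm (E : S.CO) : S.CO := E.image S.isMap_φ_symm S.sBijective_φ_symm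

theorem CO.φ_φ_symm (E : S.CO) : E.φ_symm.φ = E :=
  Subtype.ext (S.φ.toEquiv.image_symm_image E.1)

theorem CO.φ_symm_φ (E : S.CO) : E.φ.φ_symm = E :=
  Subtype.ext (S.φ.toEquiv.symm_image_image E.1)

theorem exists_shift_hom (S : SmaleSpace A) :
    ∃ s : S.Ds →+ S.Ds, Function.Injective s ∧ ∀ E : S.CO, s (S.cls E) = S.cls E.φ := by
  obtain ⟨s, hs⟩ := exists_Ds_hom (S := S) (fun E => S.cls E.φ)
    (fun E F h => cls_eq_of_rel (Rel.shift _ _ _ _ rfl rfl h))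
    (fun E F H hdisj hH => cls_union (disjoint_image_of_injective S.φ.injective hdisj)
      ((congrArg (S.φ '' ·) hH).trans (image_union _ _ _)))
  obtain ⟨t, ht⟩ := exists_Ds_hom (S := S) (fun E => S.cls E.φ_symm)
    (fun E F h => cls_eq_of_rel (Rel.unshift _ _ E F (congrArg Subtype.val E.φ_φ_symm.symm)
      (congrArg Subtype.val F.φ_φ_symm.symm) h))
    (fun E F H hdisj hH => cls_union (disjoint_image_of_injective S.φ.symm.injective hdisj)
      ((congrArg (S.φ.symm '' ·) hH).trans (image_union _ _ _)))
  have hts : t.comp s = AddMonoidHom.id _ := Ds_hom_ext fun E => by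
    rw [AddMonoidHom.comp_apply, hs, ht, E.φ_symm_φ, AddMonoidHom.id_apply]
  exact ⟨s, Function.LeftInverse.injective (DFunLike.congr_fun hts), hs⟩

theorem IsPartition.image_φ {ι : Type*} {W : Set A} {P : ι → S.CO} (hP : S.IsPartition W P) :
    S.IsPartition (S.φ '' W) fun i => (P i).φ := by
  refine ⟨fun i j hij => disjoint_image_of_injective S.φ.injective (hP.1 i j hij), ?_⟩
  rw [← hP.2, image_iUnion]
  rfl

theorem IsCompactOpen.cls_image_φ {W V : Set A} (hW : S.IsCompactOpen W) (hV : S.IsCompactOpen V)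
    (h : V = S.φ '' W) {s : S.Ds →+ S.Ds} (hs : ∀ E : S.CO, s (S.cls E) = S.cls E.φ) :
    hV.cls = s hW.cls := by
  subst h
  obtain ⟨n, P, hP⟩ := hW.exists_isPartition
  rw [← hP.sum_cls hW, ← hP.image_φ.sum_cls hV, map_sum]
  exact Finset.sum_congr rfl fun i _ => (hs _).symm

end Shift

section UnstableCorr

variable {A B : Type*} [MetricSpace A] [CompactSpace A] [MetricSpace B] [CompactSpace B]
  {S : SmaleSpace A} {T : SmaleSpace B} {f : A → B} {η c : ℝ}

variable (S) in
/-- `R` is the graph of a homeomorphism between `E` and `F` that moves points by at most `η` along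
local unstable sets. -/
structure IsUnstableCorr (η : ℝ) (E F : Set A) (R : Set (A × A)) : Prop where
  isCompact : IsCompact R
  bijOn_fst : BijOn Prod.fst R E
  bijOn_snd : BijOn Prod.snd R F
  dist_le : ∀ p ∈ R, dist p.1 p.2 ≤ η
  locallyUnstable : ∀ p ∈ R, S.inv.LocallyStable p.1 p.2

theorem bijOn_swap_preimage {α β : Type*} (R : Set (α × β)) :
    BijOn Prod.swap (Prod.swap ⁻¹' R) R :=
  ⟨mapsTo_preimage _ _, Prod.swap_injective.injOn, fun p hp =>
    ⟨p.swap, by rwa [mem_preimage, p.swap_swap], p.swap_swap⟩⟩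

theorem bijOn_snd_of_swap {α β : Type*} {R : Set (α × β)} {F : Set β}
    (h : BijOn Prod.fst (Prod.swap ⁻¹' R) F) : BijOn Prod.snd R F :=
  h.comp (bijOn_swap_preimage (Prod.swap ⁻¹' R))

theorem bijOn_image_of_bijOn_comp {α β γ : Type*} {m : α → β} {g : β → γ} {R : Set α} {V : Set γ}
    (h : BijOn (g ∘ m) R V) : BijOn g (m '' R) V :=
  ⟨mapsTo_image_iff.2 h.mapsTo, h.injOn.image_of_comp, by
    rw [SurjOn, ← image_comp]
    exact h.surjOn⟩

namespace IsUnstableCorr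

variable {E F : Set A} {R : Set (A × A)}

theorem mono (h : S.IsUnstableCorr η E F R) (hηc : η ≤ c) : S.IsUnstableCorr c E F R :=
  { h with dist_le := fun p hp => (h.dist_le p hp).trans hηc }

theorem symm (h : S.IsUnstableCorr η E F R) : S.IsUnstableCorr η F E (Prod.swap ⁻¹' R) where
  isCompact := (h.isCompact.isClosed.preimage continuous_swap).isCompact
  bijOn_fst := h.bijOn_snd.comp (bijOn_swap_preimage R)
  bijOn_snd := h.bijOn_fst.comp (bijOn_swap_preimage R)
  dist_le p hp := by
    rw [dist_comm]
    exact h.dist_le _ hp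
  locallyUnstable p hp := (h.locallyUnstable _ hp).symm

theorem map (h : S.IsUnstableCorr η E F R) (hf : Continuous f) (hE : InjOn f E) (hF : InjOn f F)
    (hR : ∀ p ∈ R, dist (f p.1) (f p.2) ≤ c ∧ T.inv.LocallyStable (f p.1) (f p.2)) :
    T.IsUnstableCorr c (f '' E) (f '' F) (Prod.map f f '' R) where
  isCompact := h.isCompact.image (hf.prodMap hf)
  bijOn_fst := by
    rw [← h.bijOn_fst.image_eq] at hE ⊢
    exact bijOn_image_of_bijOn_comp (hE.bijOn_image.comp h.bijOn_fst.injOn.bijOn_image)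
  bijOn_snd := by
    rw [← h.bijOn_snd.image_eq] at hF ⊢
    exact bijOn_image_of_bijOn_comp (hF.bijOn_image.comp h.bijOn_snd.injOn.bijOn_image)
  dist_le := forall_mem_image.2 fun p hp => (hR p hp).1
  locallyUnstable := forall_mem_image.2 fun p hp => (hR p hp).2

theorem image_φ_symm (h : S.IsUnstableCorr η E F R) :
    S.IsUnstableCorr (S.lam * η) (S.φ.symm '' E) (S.φ.symm '' F)
      (Prod.map S.φ.symm S.φ.symm '' R) :=
  h.map S.φ.symm.continuous S.φ.symm.injective.injOn S.φ.symm.injective.injOn fun p hp =>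
    have hp' := h.locallyUnstable p hp
    ⟨(S.inv.C1 _ _ hp'.dist_le hp'.bracket_eq).trans
      (mul_le_mul_of_nonneg_left (h.dist_le p hp) S.lam_pos.le), hp'.map_φ⟩

theorem restrict (h : S.IsUnstableCorr η E F R) {C : Set (A × A)} (hC : IsCompact C)
    (hCR : C ⊆ R) : S.IsUnstableCorr η (Prod.fst '' C) (Prod.snd '' C) C where
  isCompact := hC
  bijOn_fst := (h.bijOn_fst.injOn.mono hCR).bijOn_image
  bijOn_snd := (h.bijOn_snd.injOn.mono hCR).bijOn_image
  dist_le p hp := h.dist_le p (hCR hp)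
  locallyUnstable p hp := h.locallyUnstable p (hCR hp)

end IsUnstableCorr

theorem IsMap.exists_unstableCorr_image (hf : S.IsMap T f) (hc : 0 < c) :
    ∃ η > 0, ∀ E F R, S.IsUnstableCorr η E F R → InjOn f E → InjOn f F →
      ∃ R', T.IsUnstableCorr c (f '' E) (f '' F) R' := by
  obtain ⟨δ, hδ, -, hunstable⟩ := hf.inv.exists_locallyStable_map
  obtain ⟨δ', hδ', hdist⟩ := Metric.uniformContinuous_iff.1 hf.uniformContinuous c hc
  obtain ⟨η, hη, hηδ⟩ := exists_between (lt_min hδ hδ')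
  refine ⟨η, hη, fun E F R hR hE hF => ⟨_, hR.map hf.1 hE hF fun p hp => ?_⟩⟩
  obtain ⟨hpδ, hpδ'⟩ := lt_min_iff.1 ((hR.dist_le p hp).trans_lt hηδ)
  exact ⟨(hdist hpδ').le, hunstable _ _ hpδ (hR.locallyUnstable p hp)⟩

variable (S f c) in
/-- The lift of the correspondence `R` along `f`: pairs of points at distance at most `c` on a
common local unstable set whose images correspond under `R`. -/
def liftCorr (R : Set (B × B)) : Set (A × A) :=
  {p | (f p.1, f p.2) ∈ R ∧ dist p.1 p.2 ≤ c ∧ S.inv.LocallyStable p.1 p.2}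

theorem liftCorr_preimage_swap {B : Type*} {f : A → B} (R : Set (B × B)) :
    S.liftCorr f c (Prod.swap ⁻¹' R) = Prod.swap ⁻¹' S.liftCorr f c R := by
  ext p
  exact and_congr_right' (and_congr (by rw [dist_comm]; rfl) ⟨.symm, .symm⟩)

theorem isCompact_liftCorr {B : Type*} [TopologicalSpace B] [T2Space B] {f : A → B}
    (hf : Continuous f) {R : Set (B × B)} (hR : IsCompact R) :
    IsCompact (S.liftCorr f c R) :=
  ((hR.isClosed.preimage (hf.prodMap hf)).inter ((isClosed_le continuous_dist
    continuous_const).inter (isClosed_setOf_locallyStable (S := S.inv)))).isCompact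

theorem bijOn_fst_liftCorr {B : Type*} {f : A → B} (hinj : ∀ x, InjOn f (S.globalUnstable x))
    {E : Set B} {R : Set (B × B)} (hR : BijOn Prod.fst R E) (hlift : ∀ a b, (f a, b) ∈ R →
      ∃ a', f a' = b ∧ dist a a' ≤ c ∧ S.inv.LocallyStable a a') :
    BijOn Prod.fst (S.liftCorr f c R) (f ⁻¹' E) := by
  refine ⟨fun p hp => hR.mapsTo hp.1, ?_, fun a ha => ?_⟩
  · rintro ⟨a, a₁⟩ ⟨hR₁, -, hu₁⟩ ⟨_, a₂⟩ ⟨hR₂, -, hu₂⟩ (rfl : a = _)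
    have hf : f a₁ = f a₂ := congrArg Prod.snd (hR.injOn hR₁ hR₂ rfl)
    exact congrArg (Prod.mk a) (hinj a hu₁.mem_globalStable hu₂.mem_globalStable hf)
  · obtain ⟨⟨_, b⟩, hp, rfl⟩ := hR.surjOn ha
    obtain ⟨a', rfl, hd, hu⟩ := hlift a b hp
    exact ⟨(a, a'), ⟨hp, hd, hu⟩, rfl⟩

theorem UBijective.exists_unstableCorr_preimage (hu : S.UBijective T f) (hf : S.IsMap T f)
    (hc : 0 < c) : ∃ η > 0, ∀ E F R, T.IsUnstableCorr η E F R →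
      ∃ R', S.IsUnstableCorr c (f ⁻¹' E) (f ⁻¹' F) R' := by
  have hinj : ∀ x, InjOn f (S.globalUnstable x) := fun x => (hu x).injOn
  obtain ⟨η', hη', hclose⟩ := hf.inv.exists_locallyStable_of_map hinj hc
  obtain ⟨η, hη, hηη'⟩ := exists_between hη'
  have hbij {E F : Set B} {R : Set (B × B)} (hR : T.IsUnstableCorr η E F R) :
      BijOn Prod.fst (S.liftCorr f c R) (f ⁻¹' E) := by
    refine bijOn_fst_liftCorr hinj hR.bijOn_fst fun a b hab => ?_
    have hub := hR.locallyUnstable _ hab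
    obtain ⟨a', ha', rfl⟩ := (hu a).surjOn hub.mem_globalStable
    obtain ⟨hd, hua⟩ := hclose a a' ha' hub ((hR.dist_le _ hab).trans_lt hηη')
    exact ⟨a', rfl, hd.le, hua⟩
  refine ⟨η, hη, fun E F R hR => ⟨S.liftCorr f c R, isCompact_liftCorr hf.1 hR.isCompact, hbij hR,
    bijOn_snd_of_swap ?_, fun p hp => hp.2.1, fun p hp => hp.2.2⟩⟩
  rw [← liftCorr_preimage_swap]
  exact hbij hR.symm

namespace Holonomic

variable {E F : Set A}

theorem symm (h : S.Holonomic E F) : S.Holonomic F E :=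
  ⟨h.2.1, h.1, fun e he f hf => by rw [dist_comm]; exact h.2.2.1 f hf e he, h.2.2.2.2, h.2.2.2.1⟩

theorem bijOn_fst (h : S.Holonomic E F) :
    BijOn Prod.fst {p : A × A | p.1 ∈ E ∧ p.2 ∈ F ∧ S.inv.LocallyStable p.1 p.2} E := by
  obtain ⟨-, ⟨x, hx⟩, hdist, hE, hF⟩ := h
  refine ⟨fun p hp => hp.1, ?_, fun e he => ?_⟩
  · rintro ⟨e, e₁⟩ ⟨-, he₁, hu₁⟩ ⟨_, e₂⟩ ⟨-, he₂, hu₂⟩ (rfl : e = _)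
    have hs := locallyStable_of_mem_localStable le_rfl (hx he₁) (hx he₂)
    exact congrArg (Prod.mk e) (hs.eq_of_inv (hu₁.symm.trans hu₂ hs.dist_le))
  · obtain ⟨-, -, y, hy, -⟩ := hE.symm.subset he
    have hye : S.bracket y e ∈ F := hF ▸ mem_image2_of_mem hy he
    exact ⟨(e, S.bracket y e), ⟨he, hye, LocallyStable.of_bracket (S := S.inv)
      (hdist e he y hy) (hdist e he _ hye)⟩, rfl⟩

theorem exists_unstableCorr (h : S.Holonomic E F) (hE : IsCompact E) (hF : IsCompact F) :
    ∃ R, S.IsUnstableCorr S.ε E F R := by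
  refine ⟨{p : A × A | p.1 ∈ E ∧ p.2 ∈ F ∧ S.inv.LocallyStable p.1 p.2}, ?_, h.bijOn_fst,
    bijOn_snd_of_swap ?_, fun p hp => h.2.2.1 _ hp.1 _ hp.2.1, fun p hp => hp.2.2⟩
  · exact ((hE.isClosed.preimage continuous_fst).inter ((hF.isClosed.preimage continuous_snd).inter
      (isClosed_setOf_locallyStable (S := S.inv)))).isCompact
  · convert h.symm.bijOn_fst using 1
    ext p
    exact ⟨fun ⟨hE, hF, hu⟩ => ⟨hF, hE, hu.symm⟩, fun ⟨hF, hE, hu⟩ => ⟨hE, hF, hu.symm⟩⟩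

end Holonomic

theorem exists_Ds_hom_of_unstableCorr {G : Type*} [AddCommGroup G] (κ : S.CO → G)
    (hadd : ∀ E F H : S.CO, Disjoint E.1 F.1 → H.1 = E.1 ∪ F.1 → κ H = κ E + κ F)
    {s : G → G} (hs : Function.Injective s) (hshift : ∀ E : S.CO, κ E.φ = s (κ E)) (hη : 0 < η)
    (hcorr : ∀ (E F : S.CO) R, S.IsUnstableCorr η E.1 F.1 R → κ E = κ F) :
    ∃ g : S.Ds →+ G, ∀ E, g (S.cls E) = κ E := by
  -- `φ⁻ⁿ` contracts unstable correspondences to any prescribed size.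
  have hcontract (n : ℕ) : ∀ (c : ℝ) (E F : S.CO) R, S.lam ^ n * c ≤ η →
      S.IsUnstableCorr c E.1 F.1 R → κ E = κ F := by
    induction n with
    | zero => exact fun c E F R hc hR => hcorr E F R (hR.mono (by simpa using hc))
    | succ n ih =>
      intro c E F R hc hR
      rw [← E.φ_φ_symm, ← F.φ_φ_symm, hshift, hshift]
      exact congrArg s (ih _ _ _ _ (by rwa [← mul_assoc, ← pow_succ]) hR.image_φ_symm)
  have hφ {E E' : S.CO} (h : E'.1 = S.φ '' E.1) : κ E' = s (κ E) := by
    rw [← hshift, show E' = E.φ from Subtype.ext h]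
  refine exists_Ds_hom κ (fun E F h => ?_) hadd
  induction h with
  | holonomic E F h =>
    obtain ⟨R, hR⟩ := h.exists_unstableCorr E.isCompactOpen.isCompact F.isCompactOpen.isCompact
    obtain ⟨n, hn⟩ := exists_pow_lt_of_lt_one (div_pos hη S.ε_pos) S.lam_lt_one
    exact hcontract n S.ε E F R ((lt_div_iff₀ S.ε_pos).1 hn).le hR
  | shift E F E' F' hE hF _ ih => rw [hφ hE, hφ hF, ih]
  | unshift E F E' F' hE hF _ ih => exact hs (by rw [← hφ hE, ← hφ hF, ih])
  | refl E => rfl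
  | symm E F _ ih => exact ih.symm
  | trans E F G _ _ ih ih' => exact ih.trans ih'

end UnstableCorr

section UnstableCorrClass

theorem exists_finite_compact_partition {M : Type*} [TopologicalSpace M] [T2Space M] {R : Set M}
    (hR : IsCompact R) [TotallyDisconnectedSpace R] {U : M → Set M}
    (hU : ∀ x ∈ R, U x ∈ 𝓝[R] x) :
    ∃ (n : ℕ) (C : Fin n → Set M), (∀ i j, i ≠ j → Disjoint (C i) (C j)) ∧ ⋃ i, C i = R ∧
      ∀ i, IsCompact (C i) ∧ ∃ x ∈ R, C i ⊆ U x := by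
  have : CompactSpace R := isCompact_iff_compactSpace.1 hR
  have hcover : TopologicalSpace.IsOpenCover fun x : R =>
      (⟨interior (Subtype.val ⁻¹' U x), isOpen_interior⟩ : TopologicalSpace.Opens R) := by
    refine TopologicalSpace.IsOpenCover.of_sets (fun _ => isOpen_interior)
      (eq_univ_of_forall fun x => mem_iUnion.2 ⟨x, mem_interior_iff_mem_nhds.2 ?_⟩)
    exact preimage_coe_mem_nhds_subtype.2 (hU x x.2)
  obtain ⟨n, D, hD, hcov, hdisj⟩ := hcover.exists_finite_nonempty_disjoint_clopen_cover
  refine ⟨n, fun i => Subtype.val '' (D i : Set R), fun i j hij => ?_, ?_, fun i => ⟨?_, ?_⟩⟩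
  · exact disjoint_image_of_injective Subtype.val_injective
      (TopologicalSpace.Clopens.coe_disjoint.2 (hdisj hij))
  · rw [← image_iUnion, univ_subset_iff.1 hcov, image_univ, Subtype.range_coe]
  · exact (D i).isClopen.isClosed.isCompact.image continuous_subtype_val
  · obtain ⟨x, hx⟩ := (hD i).2
    exact ⟨x, x.2, image_subset_iff.2 (hx.trans interior_subset)⟩

theorem disjoint_image_and_iUnion_image_of_bijOn {α β ι : Type*} {g : α → β} {R : Set α}
    {W : Set β} {C : ι → Set α} (hg : BijOn g R W) (hdisj : ∀ i j, i ≠ j → Disjoint (C i) (C j))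
    (hunion : ⋃ i, C i = R) :
    (∀ i j, i ≠ j → Disjoint (g '' C i) (g '' C j)) ∧ ⋃ i, g '' C i = W := by
  subst hunion
  refine ⟨fun i j hij => (hdisj i j hij).image hg.injOn (subset_iUnion C i) (subset_iUnion C j), ?_⟩
  rw [← image_iUnion, hg.image_eq]

variable {A : Type*} [MetricSpace A] [CompactSpace A] {S : SmaleSpace A} {η : ℝ} {E F : Set A}
  {R : Set (A × A)}

theorem totallyDisconnectedSpace_stableTopology
    (h : ∀ x, @IsTotallyDisconnected A S.stableTopology (S.globalStable x)) :
    @TotallyDisconnectedSpace A S.stableTopology := by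
  let := S.stableTopology
  refine ⟨fun t _ ht x hx y hy => h x t ?_ ht hx hy⟩
  exact ht.subset_isClopen ⟨isClosed_globalStable x, isOpen_globalStable x⟩
    ⟨x, hx, mem_globalStable_self x⟩

theorem Flat.localStable_mem_nhdsWithin (hE : S.Flat E) {x : A} (hx : x ∈ E) {δ : ℝ} (hδ : 0 < δ)
    (hδε : δ ≤ S.ε) : S.localStable x δ ∈ 𝓝[E] x :=
  hE.continuousOn_id x hx (@IsOpen.mem_nhds A S.stableTopology x _ (isOpen_localStable x hδε)
    (mem_localStable_self x hδ))

namespace IsUnstableCorr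

theorem totallyDisconnectedSpace (h : S.IsUnstableCorr η E F R) (hE : S.Flat E)
    (htd : @TotallyDisconnectedSpace A S.stableTopology) : TotallyDisconnectedSpace R := by
  have hcont : @Continuous R A _ S.stableTopology fun p => p.1.1 :=
    @ContinuousOn.comp_continuous R A A _ _ S.stableTopology id _ E hE.continuousOn_id
      (continuous_fst.comp continuous_subtype_val) fun p => h.bijOn_fst.mapsTo p.2
  refine ⟨@isTotallyDisconnected_of_image R A _ univ S.stableTopology _
    (@Continuous.continuousOn R A _ S.stableTopology _ _ hcont) ?_
    (@isTotallyDisconnected_of_totallyDisconnectedSpace A S.stableTopology htd _)⟩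
  exact fun p q hpq => Subtype.ext (h.bijOn_fst.injOn p.2 q.2 hpq)

theorem image2_bracket_eq (h : S.IsUnstableCorr η E F R) (hη : η ≤ S.ε / 2) {e : A}
    (hE : E ⊆ S.localStable e (S.ε / 4)) :
    (∀ x ∈ E, ∀ y ∈ F, dist x y ≤ S.ε) ∧ image2 S.bracket E F = E := by
  have hε := S.ε_pos
  have hdist : ∀ x ∈ E, ∀ p ∈ R, dist x p.2 ≤ S.ε := fun x hx p hp => by
    have hd := (hE hx).1
    have hd' := (hE (h.bijOn_fst.mapsTo hp)).1
    linarith [dist_triangle_left x p.1 e, dist_triangle x p.1 p.2, h.dist_le p hp]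
  have hbracket : ∀ x ∈ E, ∀ p ∈ R, S.bracket x p.2 = p.1 := fun x hx p hp =>
    (locallyStable_of_mem_localStable (by linarith) (hE hx)
      (hE (h.bijOn_fst.mapsTo hp))).bracket_eq_of_inv (h.locallyUnstable p hp) (hdist x hx p hp)
  refine ⟨?_, Subset.antisymm (image2_subset_iff.2 ?_) fun x hx => ?_⟩
  · rw [← h.bijOn_snd.image_eq]
    exact fun x hx => forall_mem_image.2 (hdist x hx)
  · rw [← h.bijOn_snd.image_eq]
    refine fun x hx => forall_mem_image.2 fun p hp => ?_
    rw [hbracket x hx p hp]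
    exact h.bijOn_fst.mapsTo hp
  · obtain ⟨p, hp, rfl⟩ := h.bijOn_fst.surjOn hx
    exact ⟨p.1, hx, p.2, h.bijOn_snd.mapsTo hp, hbracket p.1 hx p hp⟩

theorem holonomic (h : S.IsUnstableCorr η E F R) (hη : η ≤ S.ε / 2) {e f : A}
    (hE : E ⊆ S.localStable e (S.ε / 4)) (hF : F ⊆ S.localStable f (S.ε / 4)) :
    S.Holonomic E F := by
  have hε : S.ε / 4 ≤ S.ε / 2 := by linarith [S.ε_pos]
  obtain ⟨hdist, hEF⟩ := h.image2_bracket_eq hη hE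
  exact ⟨⟨e, hE.trans (localStable_mono e hε)⟩, ⟨f, hF.trans (localStable_mono f hε)⟩, hdist, hEF,
    (h.symm.image2_bracket_eq hη hF).2⟩

theorem cls_eq_of_subset_localStable (h : S.IsUnstableCorr η E F R) (hη : η ≤ S.ε / 2) {e f : A}
    (hE : E ⊆ S.localStable e (S.ε / 4)) (hF : F ⊆ S.localStable f (S.ε / 4))
    (hcE : S.IsCompactOpen E) (hcF : S.IsCompactOpen F) : hcE.cls = hcF.cls := by
  have hε : S.ε / 4 ≤ S.ε := by linarith [S.ε_pos]
  let E' : S.CO := ⟨E, ⟨e, hE.trans (localStable_subset_globalStable hε)⟩, hcE⟩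
  let F' : S.CO := ⟨F, ⟨f, hF.trans (localStable_subset_globalStable hε)⟩, hcF⟩
  rw [hcE.cls_eq_cls E' rfl, hcF.cls_eq_cls F' rfl]
  exact cls_eq_of_rel (Rel.holonomic _ _ (h.holonomic hη hE hF))

theorem exists_partition_subset_localStable (h : S.IsUnstableCorr η E F R) (hE : S.Flat E)
    (hF : S.Flat F) (htd : @TotallyDisconnectedSpace A S.stableTopology) {δ : ℝ} (hδ : 0 < δ)
    (hδε : δ ≤ S.ε) :
    ∃ (n : ℕ) (C : Fin n → Set (A × A)), (∀ i j, i ≠ j → Disjoint (C i) (C j)) ∧ ⋃ i, C i = R ∧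
      ∀ i, IsCompact (C i) ∧
        ∃ p ∈ R, C i ⊆ S.localStable p.1 δ ×ˢ S.localStable p.2 δ := by
  have := h.totallyDisconnectedSpace hE htd
  refine exists_finite_compact_partition h.isCompact fun p hp => Filter.inter_mem ?_ ?_
  · exact continuousWithinAt_fst.tendsto_nhdsWithin h.bijOn_fst.mapsTo
      (hE.localStable_mem_nhdsWithin (h.bijOn_fst.mapsTo hp) hδ hδε)
  · exact continuousWithinAt_snd.tendsto_nhdsWithin h.bijOn_snd.mapsTo
      (hF.localStable_mem_nhdsWithin (h.bijOn_snd.mapsTo hp) hδ hδε)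

theorem cls_eq (h : S.IsUnstableCorr η E F R) (hη : η ≤ S.ε / 2) (hE : S.IsCompactOpen E)
    (hF : S.IsCompactOpen F) (htd : @TotallyDisconnectedSpace A S.stableTopology) :
    hE.cls = hF.cls := by
  have hε := S.ε_pos
  obtain ⟨n, C, hdisj, hunion, hC⟩ := h.exists_partition_subset_localStable
    (flat_of_isCompact_stableTopology hE.1) (flat_of_isCompact_stableTopology hF.1) htd
    (δ := S.ε / 4) (by linarith) (by linarith)
  obtain ⟨hdisjE, hunionE⟩ := disjoint_image_and_iUnion_image_of_bijOn h.bijOn_fst hdisj hunion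
  obtain ⟨hdisjF, hunionF⟩ := disjoint_image_and_iUnion_image_of_bijOn h.bijOn_snd hdisj hunion
  have hCE := hE.of_iUnion_eq (fun i => ((hC i).1.image continuous_fst).isClosed) hdisjE hunionE
  have hCF := hF.of_iUnion_eq (fun i => ((hC i).1.image continuous_snd).isClosed) hdisjF hunionF
  rw [IsCompactOpen.cls_iUnion hCE hdisjE hunionE, IsCompactOpen.cls_iUnion hCF hdisjF hunionF]
  refine Finset.sum_congr rfl fun i _ => ?_
  obtain ⟨hCi, p, -, hCp⟩ := hC i
  exact (h.restrict hCi (hunion ▸ subset_iUnion C i)).cls_eq_of_subset_localStable hη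
    (image_subset_iff.2 fun q hq => (hCp hq).1) (image_subset_iff.2 fun q hq => (hCp hq).2) _ _

end IsUnstableCorr

end UnstableCorrClass

section InducedMaps

variable {A B C D : Type*} [MetricSpace A] [CompactSpace A] [MetricSpace B] [CompactSpace B]
  [MetricSpace C] [CompactSpace C] [MetricSpace D] [CompactSpace D] {S : SmaleSpace A}
  {T : SmaleSpace B} {U : SmaleSpace C} {V : SmaleSpace D}

theorem IsCompactOpen.iUnion {ι : Type*} [Finite ι] {W : ι → Set A}
    (hW : ∀ i, S.IsCompactOpen (W i)) : S.IsCompactOpen (⋃ i, W i) :=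
  ⟨@isCompact_iUnion A S.stableTopology ι W _ fun i => (hW i).1,
    @isOpen_iUnion A ι S.stableTopology W fun i => (hW i).2⟩

theorem isPull_iff {f : A → B} {g : T.Ds →+ S.Ds} :
    S.IsPull T f g ↔ ∀ E : T.CO, ∃ h : S.IsCompactOpen (f ⁻¹' E.1), g (T.cls E) = h.cls := by
  refine ⟨fun hg E => ?_, fun hg E => ?_⟩
  · obtain ⟨⟨n, P, hP⟩, hsum⟩ := hg E
    have h : S.IsCompactOpen (f ⁻¹' E.1) := hP.2 ▸ IsCompactOpen.iUnion fun i => (P i).isCompactOpen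
    exact ⟨h, (hsum n P hP).trans (IsPartition.sum_cls hP h)⟩
  · obtain ⟨h, hcls⟩ := hg E
    exact ⟨h.exists_isPartition, fun n P hP => hcls.trans (IsPartition.sum_cls hP h).symm⟩

namespace IsPush

variable {f : A → B} {g : S.Ds →+ T.Ds}

theorem unique {g' : S.Ds →+ T.Ds} (hg : S.IsPush T f g) (hg' : S.IsPush T f g') : g = g' := by
  refine Ds_hom_ext fun E => ?_
  obtain ⟨F, hF, hgF⟩ := hg E
  obtain ⟨F', hF', hgF'⟩ := hg' E
  rw [hgF, hgF', show F = F' from Subtype.ext (hF.trans hF'.symm)]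

theorem id : S.IsPush S id (AddMonoidHom.id _) := fun E => ⟨E, (image_id E.1).symm, rfl⟩

theorem comp {f' : B → C} {g' : T.Ds →+ U.Ds} (hg' : T.IsPush U f' g') (hg : S.IsPush T f g) :
    S.IsPush U (f' ∘ f) (g'.comp g) := by
  intro E
  obtain ⟨F, hF, hgF⟩ := hg E
  obtain ⟨F', hF', hgF'⟩ := hg' F
  exact ⟨F', by rw [hF', hF, image_comp], by rw [AddMonoidHom.comp_apply, hgF, hgF']⟩

theorem cls_image (hg : S.IsPush T f g) {W : Set A} (hW : S.IsCompactOpen W) (hinj : InjOn f W) :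
    ∃ h : T.IsCompactOpen (f '' W), g hW.cls = h.cls := by
  obtain ⟨n, P, hP⟩ := hW.exists_isPartition
  choose Q hQ hgQ using fun i => hg (P i)
  have hQW : T.IsPartition (f '' W) Q := by
    refine ⟨fun i j hij => ?_, ?_⟩
    · rw [hQ, hQ]
      exact (hP.1 i j hij).image hinj (hP.subset i) (hP.subset j)
    · simp only [hQ, ← image_iUnion, hP.2]
  have h : T.IsCompactOpen (f '' W) :=
    hQW.2 ▸ IsCompactOpen.iUnion fun i => (Q i).isCompactOpen
  refine ⟨h, ?_⟩
  rw [← hP.sum_cls hW, map_sum, ← hQW.sum_cls h]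
  exact Finset.sum_congr rfl fun i _ => hgQ i

end IsPush

namespace IsPull

variable {f : A → B} {g : T.Ds →+ S.Ds}

theorem unique {g' : T.Ds →+ S.Ds} (hg : S.IsPull T f g) (hg' : S.IsPull T f g') : g = g' :=
  Ds_hom_ext fun E =>
    (isPull_iff.1 hg E).choose_spec.trans (isPull_iff.1 hg' E).choose_spec.symm

theorem id : S.IsPull S id (AddMonoidHom.id _) :=
  isPull_iff.2 fun E => ⟨E.isCompactOpen, E.cls_isCompactOpen.symm⟩

theorem cls_preimage (hg : S.IsPull T f g) {W : Set B} (hW : T.IsCompactOpen W) :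
    ∃ h : S.IsCompactOpen (f ⁻¹' W), g hW.cls = h.cls := by
  obtain ⟨n, P, hP⟩ := hW.exists_isPartition
  choose h hcls using fun i => isPull_iff.1 hg (P i)
  have hunion : ⋃ i, f ⁻¹' (P i).1 = f ⁻¹' W := by rw [← preimage_iUnion, hP.2]
  have hfW : S.IsCompactOpen (f ⁻¹' W) := hunion ▸ IsCompactOpen.iUnion h
  refine ⟨hfW, ?_⟩
  rw [IsCompactOpen.cls_iUnion h (fun i j hij => (hP.1 i j hij).preimage f) hunion,
    ← hP.sum_cls hW, map_sum]
  exact Finset.sum_congr rfl fun i _ => hcls i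

theorem comp {f' : B → C} {g' : U.Ds →+ T.Ds} (hg : S.IsPull T f g) (hg' : T.IsPull U f' g') :
    S.IsPull U (f' ∘ f) (g.comp g') := by
  refine isPull_iff.2 fun E => ?_
  obtain ⟨h', hcls'⟩ := isPull_iff.1 hg' E
  obtain ⟨h, hcls⟩ := hg.cls_preimage h'
  exact ⟨h, by rw [AddMonoidHom.comp_apply, hcls', hcls]⟩

end IsPull

/-- Base change: for a pullback square of sets, `p (q⁻¹ E) = q'⁻¹ (p' E)`, and `p` is injective on
`q⁻¹ E`. -/
theorem IsPush.comp_eq_comp_of_pullback {p : A → B} {q : A → C} {p' : C → D} {q' : B → D}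
    {g : S.Ds →+ T.Ds} {k : U.Ds →+ S.Ds} {g' : U.Ds →+ V.Ds} {k' : V.Ds →+ T.Ds}
    (hg : S.IsPush T p g) (hk : S.IsPull U q k) (hg' : U.IsPush V p' g') (hk' : T.IsPull V q' k')
    (hinj : ∀ x, InjOn p' (U.globalStable x)) (hcomm : ∀ a, q' (p a) = p' (q a))
    (hpullback : ∀ b c, q' b = p' c → ∃! a, p a = b ∧ q a = c) : g.comp k = k'.comp g' := by
  refine Ds_hom_ext fun E => ?_
  have hinj_p : InjOn p (q ⁻¹' E.1) := fun a ha a' ha' h =>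
    have hq : q a = q a' := E.injOn hinj ha ha' (by rw [← hcomm, ← hcomm, h])
    (hpullback _ _ (hcomm a')).unique ⟨h, hq⟩ ⟨rfl, rfl⟩
  have himage : q' ⁻¹' (p' '' E.1) = p '' (q ⁻¹' E.1) := by
    refine Subset.antisymm ?_ (image_subset_iff.2 fun a ha => ⟨q a, ha, (hcomm a).symm⟩)
    rintro b ⟨c, hc, hcb⟩
    obtain ⟨a, ⟨rfl, rfl⟩, -⟩ := hpullback b c hcb.symm
    exact ⟨a, hc, rfl⟩
  obtain ⟨hW, hkE⟩ := isPull_iff.1 hk E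
  obtain ⟨hpW, hgW⟩ := hg.cls_image hW hinj_p
  obtain ⟨F, hF, hgF⟩ := hg' E
  obtain ⟨hW', hkF⟩ := isPull_iff.1 hk' F
  have hcls : hW'.cls = hpW.cls := by
    congr 1
    rw [hF, himage]
  rw [AddMonoidHom.comp_apply, AddMonoidHom.comp_apply, hkE, hgW, hgF, hkF, hcls]

theorem SBijective.isPush_push {f : A → B} (hb : S.SBijective T f) (hf : S.IsMap T f)
    (htd : @TotallyDisconnectedSpace B T.stableTopology) : S.IsPush T f (S.push T f) := by
  have hinj x := (hb x).injOn
  obtain ⟨s, hs, hshift⟩ := T.exists_shift_hom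
  obtain ⟨η, hη, hcorr⟩ := hf.exists_unstableCorr_image (half_pos T.ε_pos)
  obtain ⟨g, hg⟩ := exists_Ds_hom_of_unstableCorr (fun E : S.CO => T.cls (E.image hf hb))
    (fun E F H hdisj hH => by
      have hinjH := hH ▸ H.injOn hinj
      exact cls_union (hdisj.image hinjH subset_union_left subset_union_right)
        ((congrArg (f '' ·) hH).trans (image_union _ _ _)))
    hs (fun E => by
      rw [hshift]
      exact congrArg T.cls (Subtype.ext (hf.image_image_φ E.1)))
    hη (fun E F R hR => by
      obtain ⟨R', hR'⟩ := hcorr E.1 F.1 R hR (E.injOn hinj) (F.injOn hinj)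
      rw [← CO.cls_isCompactOpen, ← CO.cls_isCompactOpen]
      exact hR'.cls_eq le_rfl _ _ htd)
  have hex : ∃ g, S.IsPush T f g := ⟨g, fun E => ⟨E.image hf hb, rfl, hg E⟩⟩
  rw [push, dif_pos hex]
  exact hex.choose_spec

theorem UBijective.isPull_pull {f : A → B} (hu : S.UBijective T f) (hf : S.IsMap T f)
    (htd : @TotallyDisconnectedSpace A S.stableTopology) : S.IsPull T f (S.pull T f) := by
  have hpre (E : T.CO) : S.IsCompactOpen (f ⁻¹' E.1) :=
    E.isCompactOpen.preimage hf fun x => (hu x).injOn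
  obtain ⟨s, hs, hshift⟩ := S.exists_shift_hom
  obtain ⟨η, hη, hcorr⟩ := hu.exists_unstableCorr_preimage hf (half_pos S.ε_pos)
  obtain ⟨g, hg⟩ := exists_Ds_hom_of_unstableCorr (fun E : T.CO => (hpre E).cls)
    (fun E F H hdisj hH => (hpre E).cls_union (hpre F) (hpre H) (hdisj.preimage f)
      ((congrArg (f ⁻¹' ·) hH).trans preimage_union))
    hs (fun E => (hpre E).cls_image_φ (hpre E.φ) (hf.preimage_image_φ E.1) hshift)
    hη (fun E F R hR => by
      obtain ⟨R', hR'⟩ := hcorr E.1 F.1 R hR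
      exact hR'.cls_eq le_rfl _ _ htd)
  have hex : ∃ g, S.IsPull T f g := ⟨g, isPull_iff.2 fun E => ⟨hpre E, hg E⟩⟩
  rw [pull, dif_pos hex]
  exact hex.choose_spec

end InducedMaps

end SmaleSpace

namespace SUBijectivePair

open Set Topology SmaleSpace Filter

section FibreProducts

theorem bijOn_of_bijOn_comp {α β γ : Type*} {f : α → β} {g : β → γ} {s : Set α} {t : Set β}
    {u : Set γ} (hf : MapsTo f s t) (hg : InjOn g t) (hu : MapsTo g t u)
    (hgf : BijOn (g ∘ f) s u) : BijOn f s t := by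
  refine ⟨hf, fun x hx y hy h => hgf.injOn hx hy (congrArg g h), fun y hy => ?_⟩
  obtain ⟨x, hx, hxy⟩ := hgf.surjOn (hu hy)
  exact ⟨x, hx, hg (hf hx) hy hxy⟩

variable {X Y Z : Type*} [MetricSpace X] [CompactSpace X] [MetricSpace Y] [CompactSpace Y]
  [MetricSpace Z] [CompactSpace Z] {S : SmaleSpace X} (π : SUBijectivePair S Y Z)

theorem isMap_fst {L M : ℕ} (l : Fin (L + 1)) : (π.sig L M).IsMap π.SY fun p => p.1.1 l :=
  ⟨by fun_prop, fun _ => rfl⟩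

theorem isMap_snd {L M : ℕ} (m : Fin (M + 1)) : (π.sig L M).IsMap π.SZ fun p => p.1.2 m :=
  ⟨by fun_prop, fun _ => rfl⟩

variable {π} {L M : ℕ} {p q : π.Sig L M}

theorem mem_globalStable_iff_of_isMap {T : SmaleSpace (π.Sig L M)} {TY : SmaleSpace Y}
    {TZ : SmaleSpace Z} (hY : ∀ l, T.IsMap TY fun p => p.1.1 l)
    (hZ : ∀ m, T.IsMap TZ fun p => p.1.2 m) :
    q ∈ T.globalStable p ↔ (∀ l, q.1.1 l ∈ TY.globalStable (p.1.1 l)) ∧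
      ∀ m, q.1.2 m ∈ TZ.globalStable (p.1.2 m) := by
  simp only [mem_globalStable_iff_tendsto, uniformity_subtype, uniformity_prod, Pi.uniformity,
    tendsto_inf, tendsto_iInf, tendsto_comap_iff, ← (hY _).iterate, ← (hZ _).iterate]
  rfl

theorem mem_globalStable_iff :
    q ∈ (π.sig L M).globalStable p ↔ (∀ l, q.1.1 l ∈ π.SY.globalStable (p.1.1 l)) ∧
      ∀ m, q.1.2 m ∈ π.SZ.globalStable (p.1.2 m) :=
  mem_globalStable_iff_of_isMap π.isMap_fst π.isMap_snd

theorem mem_globalUnstable_iff :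
    q ∈ (π.sig L M).globalUnstable p ↔ (∀ l, q.1.1 l ∈ π.SY.globalUnstable (p.1.1 l)) ∧
      ∀ m, q.1.2 m ∈ π.SZ.globalUnstable (p.1.2 m) :=
  mem_globalStable_iff_of_isMap (T := (π.sig L M).inv) (TY := π.SY.inv) (TZ := π.SZ.inv)
    (fun l => (π.isMap_fst l).inv) fun m => (π.isMap_snd m).inv

variable (π)

theorem bijOn_snd_globalStable (p : π.Sig L M) :
    BijOn (fun q : π.Sig L M => q.1.2) ((π.sig L M).globalStable p)
      {z | (∀ m, z m ∈ π.SZ.globalStable (p.1.2 m)) ∧ ∀ m m', π.πu (z m) = π.πu (z m')} := by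
  refine ⟨fun q hq => ⟨(mem_globalStable_iff.1 hq).2, fun m m' => ?_⟩, fun q hq r hr hqr => ?_,
    fun z hz => ?_⟩
  · rw [← q.2 0 m, ← q.2 0 m']
  · refine Subtype.ext (Prod.ext (funext fun l => ?_) hqr)
    refine (π.sBijective_πs (p.1.1 l)).injOn ((mem_globalStable_iff.1 hq).1 l)
      ((mem_globalStable_iff.1 hr).1 l) ?_
    rw [q.2 l 0, r.2 l 0]
    exact congrArg π.πu (congrFun hqr 0)
  · have hlift (l) : ∃ y ∈ π.SY.globalStable (p.1.1 l), π.πs y = π.πu (z 0) := by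
      refine (π.sBijective_πs (p.1.1 l)).surjOn ?_
      rw [p.2 l 0]
      exact π.isMap_πu.mem_globalStable (hz.1 0)
    choose y hy hyz using hlift
    exact ⟨⟨(y, z), fun l m => (hyz l).trans (hz.2 0 m)⟩, mem_globalStable_iff.2 ⟨hy, hz.1⟩, rfl⟩

theorem bijOn_fst_globalUnstable (p : π.Sig L M) :
    BijOn (fun q : π.Sig L M => q.1.1) ((π.sig L M).globalUnstable p)
      {y | (∀ l, y l ∈ π.SY.globalUnstable (p.1.1 l)) ∧ ∀ l l', π.πs (y l) = π.πs (y l')} := by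
  refine ⟨fun q hq => ⟨(mem_globalUnstable_iff.1 hq).1, fun l l' => ?_⟩, fun q hq r hr hqr => ?_,
    fun y hy => ?_⟩
  · rw [q.2 l 0, q.2 l' 0]
  · refine Subtype.ext (Prod.ext hqr (funext fun m => ?_))
    refine (π.uBijective_πu (p.1.2 m)).injOn ((mem_globalUnstable_iff.1 hq).2 m)
      ((mem_globalUnstable_iff.1 hr).2 m) ?_
    rw [← q.2 0 m, ← r.2 0 m]
    exact congrArg π.πs (congrFun hqr 0)
  · have hlift (m) : ∃ z ∈ π.SZ.globalUnstable (p.1.2 m), π.πu z = π.πs (y 0) := by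
      refine (π.uBijective_πu (p.1.2 m)).surjOn ?_
      rw [← p.2 0 m]
      exact π.isMap_πs.inv.mem_globalStable (hy.1 0)
    choose z hz hzy using hlift
    exact ⟨⟨(y, z), fun l m => (hy.2 l 0).trans (hzy m).symm⟩,
      mem_globalUnstable_iff.2 ⟨hy.1, hz⟩, rfl⟩

theorem totallyDisconnectedSpace_sig (L M : ℕ) :
    @TotallyDisconnectedSpace (π.Sig L M) (π.sig L M).stableTopology := by
  refine totallyDisconnectedSpace_stableTopology fun p t ht hpre a ha b hb => ?_
  refine (π.bijOn_snd_globalStable p).injOn (ht ha) (ht hb) (funext fun m => ?_)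
  have himage := @IsPreconnected.image _ _ (π.sig L M).stableTopology π.SZ.stableTopology t hpre
    (fun q => q.1.2 m) (@Continuous.continuousOn _ _ (π.sig L M).stableTopology
      π.SZ.stableTopology _ t (π.isMap_snd m).continuous_stableTopology)
  exact π.totallyDisconnected_stable (p.1.2 m) _
    (image_subset_iff.2 fun q hq => (mem_globalStable_iff.1 (ht hq)).2 m) himage
    (mem_image_of_mem _ ha) (mem_image_of_mem _ hb)

variable {L' M' : ℕ} (α : Fin (L' + 1) → Fin (L + 1)) (β : Fin (M' + 1) → Fin (M + 1))

theorem isMap_reindexY : (π.sig L M).IsMap (π.sig L' M) (π.reindexY M α) :=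
  ⟨by unfold reindexY; fun_prop, fun _ => rfl⟩

theorem isMap_reindexZ : (π.sig L M).IsMap (π.sig L M') (π.reindexZ L β) :=
  ⟨by unfold reindexZ; fun_prop, fun _ => rfl⟩

theorem sBijective_reindexY : (π.sig L M).SBijective (π.sig L' M) (π.reindexY M α) := fun p =>
  have h := π.bijOn_snd_globalStable (π.reindexY M α p)
  bijOn_of_bijOn_comp (fun _ => (π.isMap_reindexY α).mem_globalStable) h.injOn h.mapsTo
    (π.bijOn_snd_globalStable p)

theorem uBijective_reindexZ : (π.sig L M).UBijective (π.sig L M') (π.reindexZ L β) := fun p =>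
  have h := π.bijOn_fst_globalUnstable (π.reindexZ L β p)
  bijOn_of_bijOn_comp (fun _ => (π.isMap_reindexZ β).inv.mem_globalStable) h.injOn h.mapsTo
    (π.bijOn_fst_globalUnstable p)

theorem isPush_covY : (π.sig L M).IsPush (π.sig L' M) (π.reindexY M α) (π.covY M α) :=
  (π.sBijective_reindexY α).isPush_push (π.isMap_reindexY α) (π.totallyDisconnectedSpace_sig L' M)

theorem isPull_conZ : (π.sig L M).IsPull (π.sig L M') (π.reindexZ L β) (π.conZ L β) :=
  (π.uBijective_reindexZ β).isPull_pull (π.isMap_reindexZ β) (π.totallyDisconnectedSpace_sig L M)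

theorem existsUnique_reindex (b : π.Sig L' M) (c : π.Sig L M')
    (h : π.reindexZ L' β b = π.reindexY M' α c) :
    ∃! a, π.reindexY M α a = b ∧ π.reindexZ L β a = c := by
  obtain ⟨⟨y', z⟩, hb⟩ := b
  obtain ⟨⟨y, z'⟩, hc⟩ := c
  obtain ⟨rfl, hz⟩ := Prod.mk.inj (Subtype.mk.inj h)
  refine ⟨⟨(y, z), fun l m => ?_⟩, ⟨rfl, Subtype.ext (Prod.ext rfl hz)⟩, ?_⟩
  · rw [← hb 0 m, hc l 0, hc (α 0) 0]
  · rintro ⟨⟨y₁, z₁⟩, _⟩ ⟨hY, hZ⟩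
    exact Subtype.ext (Prod.ext (Prod.mk.inj (Subtype.mk.inj hZ)).1
      (Prod.mk.inj (Subtype.mk.inj hY)).2)

theorem covY_comp_conZ :
    (π.covY M α).comp (π.conZ L β) = (π.conZ L' β).comp (π.covY M' α) :=
  (π.isPush_covY α).comp_eq_comp_of_pullback (π.isPull_conZ β) (π.isPush_covY α)
    (π.isPull_conZ β) (fun x => (π.sBijective_reindexY α x).injOn) (fun _ => rfl)
    (π.existsUnique_reindex α β)

theorem dsFunctorial : π.DsFunctorial where
  covY_id _ _ := (π.isPush_covY id).unique IsPush.id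
  covY_comp _ α α' :=
    (π.isPush_covY (α ∘ α')).unique ((π.isPush_covY α').comp (π.isPush_covY α))
  conZ_id _ _ := (π.isPull_conZ id).unique IsPull.id
  conZ_comp _ _ _ _ β β' :=
    (π.isPull_conZ (β ∘ β')).unique ((π.isPull_conZ β).comp (π.isPull_conZ β'))
  comm α β := π.covY_comp_conZ α β

end FibreProducts

end SUBijectivePair

theorem MixedDoubleComplex.mk_congr {obj : ℕ → ℕ → AddCommGrpCat.{u}}
    {dh dh' : ∀ L M, obj (L + 1) M ⟶ obj L M} {dv dv' : ∀ L M, obj L M ⟶ obj L (M + 1)}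
    (hh : ∀ L M, dh (L + 1) M ≫ dh L M = 0) (hv : ∀ L M, dv L M ≫ dv L (M + 1) = 0)
    (hhv : ∀ L M, dh L M ≫ dv L M + dv (L + 1) M ≫ dh L (M + 1) = 0)
    (hh' : ∀ L M, dh' (L + 1) M ≫ dh' L M = 0) (hv' : ∀ L M, dv' L M ≫ dv' L (M + 1) = 0)
    (hhv' : ∀ L M, dh' L M ≫ dv' L M + dv' (L + 1) M ≫ dh' L (M + 1) = 0)
    (hdh : dh = dh') (hdv : dv = dv') :
    MixedDoubleComplex.mk obj dh dv hh hv hhv = ⟨obj, dh', dv', hh', hv', hhv'⟩ := by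
  subst hdh hdv
  rfl

theorem unnormalizedDoubleComplex_dh (F : SimplicialObject (CosimplicialObject AddCommGrpCat.{u}))
    (L M : ℕ) :
    (unnormalizedDoubleComplex F).dh L M =
      ∑ l : Fin (L + 2), (-1 : ℤ) ^ (l : ℕ) • (F.δ l).app (SimplexCategory.mk M) := by
  refine (congrArg (fun f => NatTrans.app f (SimplexCategory.mk M))
    (AlgebraicTopology.alternatingFaceMapComplex_obj_d F L)).trans ?_
  let appM : (F.obj (op (SimplexCategory.mk (L + 1))) ⟶ F.obj (op (SimplexCategory.mk L))) →+
      ((F.obj (op (SimplexCategory.mk (L + 1)))).obj (SimplexCategory.mk M) ⟶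
        (F.obj (op (SimplexCategory.mk L))).obj (SimplexCategory.mk M)) :=
    { toFun f := f.app (SimplexCategory.mk M)
      map_zero' := rfl
      map_add' _ _ := rfl }
  change appM (∑ l : Fin (L + 2), (-1 : ℤ) ^ (l : ℕ) • F.δ l) = _
  simp only [map_sum, map_zsmul]
  rfl

theorem unnormalizedDoubleComplex_dv (F : SimplicialObject (CosimplicialObject AddCommGrpCat.{u}))
    (L M : ℕ) :
    (unnormalizedDoubleComplex F).dv L M = ∑ m : Fin (M + 2), (-1 : ℤ) ^ (L + (m : ℕ)) •
      CosimplicialObject.δ (F.obj (op (SimplexCategory.mk L))) m := by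
  refine (congrArg ((-1 : ℤ) ^ L • ·) (CochainComplex.of_d
    (fun n => (F.obj (op (SimplexCategory.mk L))).obj (SimplexCategory.mk n)) _ M)).trans ?_
  change (-1 : ℤ) ^ L • ∑ m : Fin (M + 2), (-1 : ℤ) ^ (m : ℕ) •
    CosimplicialObject.δ (F.obj (op (SimplexCategory.mk L))) m = _
  simp only [Finset.smul_sum, smul_smul, pow_add]

namespace SUBijectivePair

section DoubleComplex

variable {X Y Z : Type*} [MetricSpace X] [CompactSpace X] [MetricSpace Y] [CompactSpace Y]
  [MetricSpace Z] [CompactSpace Z] {S : SmaleSpace X} (π : SUBijectivePair S Y Z)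
  (h : π.DsFunctorial) (L M : ℕ)

theorem dsObject_dh :
    (unnormalizedDoubleComplex (π.dsObject h)).dh L M = AddCommGrpCat.ofHom (π.dS L M) := by
  rw [unnormalizedDoubleComplex_dh]
  apply AddCommGrpCat.homAddEquiv.injective
  rw [map_sum]
  simp only [map_zsmul]
  rfl

theorem dsObject_dv :
    (unnormalizedDoubleComplex (π.dsObject h)).dv L M = AddCommGrpCat.ofHom (π.dSStar L M) := by
  rw [unnormalizedDoubleComplex_dv]
  apply AddCommGrpCat.homAddEquiv.injective
  rw [map_sum]
  simp only [map_zsmul]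
  rfl

include h in
theorem isDoubleComplex : π.IsDoubleComplex where
  dS_dS L M := by
    have hdd := (unnormalizedDoubleComplex (π.dsObject h)).dh_dh L M
    rw [dsObject_dh, dsObject_dh] at hdd
    exact congrArg AddCommGrpCat.Hom.hom hdd
  dSStar_dSStar L M := by
    have hdd := (unnormalizedDoubleComplex (π.dsObject h)).dv_dv L M
    rw [dsObject_dv, dsObject_dv] at hdd
    exact congrArg AddCommGrpCat.Hom.hom hdd
  anticomm L M := by
    have hanti := (unnormalizedDoubleComplex (π.dsObject h)).anticomm L M
    rw [dsObject_dv, dsObject_dv, dsObject_dh, dsObject_dh] at hanti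
    exact congrArg AddCommGrpCat.Hom.hom hanti

theorem unnormalizedDoubleComplex_eq :
    unnormalizedDoubleComplex (π.dsObject h) = π.putnamComplex (π.isDoubleComplex h) :=
  MixedDoubleComplex.mk_congr _ _ _ _ _ _ (funext₂ (π.dsObject_dh h)) (funext₂ (π.dsObject_dv h))

end DoubleComplex

end SUBijectivePair

theorem mainTheorem8_general {X Y Z : Type*} [MetricSpace X] [CompactSpace X] [MetricSpace Y]
    [CompactSpace Y] [MetricSpace Z] [CompactSpace Z] {S : SmaleSpace X}
    (π : SUBijectivePair S Y Z) :
    (∀ (L L' M : ℕ) (α : Fin (L' + 1) → Fin (L + 1)),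
      (π.sig L M).IsPush (π.sig L' M) (π.reindexY M α) (π.covY M α)) ∧
    (∀ (L M M' : ℕ) (β : Fin (M' + 1) → Fin (M + 1)),
      (π.sig L M).IsPull (π.sig L M') (π.reindexZ L β) (π.conZ L β)) ∧
    ∃ h : π.DsFunctorial,
      (∀ (L M : ℕ) (l : Fin (L + 2)),
        ((π.dsObject h).δ l).app (SimplexCategory.mk M) =
          AddCommGrpCat.ofHom ((π.sig (L + 1) M).push (π.sig L M) (π.faceY L M l))) ∧
      (∀ (L M : ℕ) (l : Fin (L + 1)),
        ((π.dsObject h).σ l).app (SimplexCategory.mk M) =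
          AddCommGrpCat.ofHom ((π.sig L M).push (π.sig (L + 1) M) (π.degenY L M l))) ∧
      (∀ (L M : ℕ) (m : Fin (M + 2)),
        CosimplicialObject.δ ((π.dsObject h).obj (op (SimplexCategory.mk L))) m =
          AddCommGrpCat.ofHom ((π.sig L (M + 1)).pull (π.sig L M) (π.faceZ L M m))) ∧
      (∀ (L M : ℕ) (m : Fin (M + 1)),
        CosimplicialObject.σ ((π.dsObject h).obj (op (SimplexCategory.mk L))) m =
          AddCommGrpCat.ofHom ((π.sig L M).pull (π.sig L (M + 1)) (π.degenZ L M m))) ∧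
      ∃ h' : π.IsDoubleComplex,
        unnormalizedDoubleComplex (π.dsObject h) = π.putnamComplex h' :=
  ⟨fun _ _ _ => π.isPush_covY, fun _ _ _ => π.isPull_conZ, π.dsFunctorial, fun _ _ _ => rfl,
    fun _ _ _ => rfl, fun _ _ _ => rfl, fun _ _ _ => rfl, π.isDoubleComplex π.dsFunctorial,
    π.unnormalizedDoubleComplex_eq π.dsFunctorial⟩

theorem mainTheorem8 {X Y Z : Type*} [MetricSpace X] [CompactSpace X] [MetricSpace Y]
    [CompactSpace Y] [MetricSpace Z] [CompactSpace Z] (S : SmaleSpace X) (hS : S.NonWandering)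
    (π : SUBijectivePair S Y Z) :
    -- the induced maps on dimension groups exist
    (∀ (L L' M : ℕ) (α : Fin (L' + 1) →o Fin (L + 1)),
      (π.sig L M).IsPush (π.sig L' M) (π.reindexY M α) (π.covY M α)) ∧
    (∀ (L M M' : ℕ) (β : Fin (M' + 1) →o Fin (M + 1)),
      (π.sig L M).IsPull (π.sig L M') (π.reindexZ L β) (π.conZ L β)) ∧
    -- they form a simplicial cosimplicial abelian group
    ∃ h : π.DsFunctorial,
      -- with the stated faces, degeneracies, cofaces and codegeneracies
      (∀ (L M : ℕ) (l : Fin (L + 2)),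
        ((π.dsObject h).δ l).app (SimplexCategory.mk M) =
          AddCommGrpCat.ofHom ((π.sig (L + 1) M).push (π.sig L M) (π.faceY L M l))) ∧
      (∀ (L M : ℕ) (l : Fin (L + 1)),
        ((π.dsObject h).σ l).app (SimplexCategory.mk M) =
          AddCommGrpCat.ofHom ((π.sig L M).push (π.sig (L + 1) M) (π.degenY L M l))) ∧
      (∀ (L M : ℕ) (m : Fin (M + 2)),
        CosimplicialObject.δ ((π.dsObject h).obj (op (SimplexCategory.mk L))) m =
          AddCommGrpCat.ofHom ((π.sig L (M + 1)).pull (π.sig L M) (π.faceZ L M m))) ∧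
      (∀ (L M : ℕ) (m : Fin (M + 1)),
        CosimplicialObject.σ ((π.dsObject h).obj (op (SimplexCategory.mk L))) m =
          AddCommGrpCat.ofHom ((π.sig L M).pull (π.sig L (M + 1)) (π.degenZ L M m))) ∧
      -- whose unnormalized double complex is Putnam's double complex
      ∃ h' : π.IsDoubleComplex,
        unnormalizedDoubleComplex (π.dsObject h) = π.putnamComplex h' := by
  obtain ⟨hpush, hpull, hfunctor⟩ := mainTheorem8_general π
  exact ⟨fun L L' M α => hpush L L' M α, fun L M M' β => hpull L M M' β, hfunctor⟩
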